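/- Let $\lambda$ be a regular cardinal and let $\mathcal V=(\mathcal V_0,\otimes,I)$ be a symmetric monoidal closed category which is locally $\lambda$-presentable as a closed category ($\mathcal V_0$ is locally $\lambda$-presentable and its $\lambda$-presentable objects contain $I$ and are closed under $\otimes$). Write $A^X=[X,A]$ for the internal hom. Let $(\mathcal E,\mathcal M)$ be an enriched factorization system on $\mathcal V$ (an orthogonal factorization system on $\mathcal V_0$ with $\mathcal E$ closed under tensoring with objects of $\mathcal V$) such that every map in $\mathcal M$ is a monomorphism and $\mathcal M$ is closed in $\mathcal V^{\to}$ under $\lambda$-directed colimits. Let $\mathbb L$ be a single-sorted $\lambda$-ary language: a set of function symbols $f:(X,Y)$ and a set of relation symbols $R:X$, with $\lambda$-presentable arities. An $\mathbb L$-structure is an object $A$ of $\mathcal V$ with morphisms $f_A\colon A^X\to A^Y$ and $\mathcal M$-subobjects $R_A\rightarrowtail A^X$; morphisms of structures are morphisms $h$ of $\mathcal V$ compatible with these, and $\mathbf{Str}(\mathbb L)$ is the resulting $\mathcal V$-category, in which a generalized element $Z\to\mathbf{Str}(\mathbb L)(A,B)$ is a map $Z\otimes A\to B$ compatible with the function and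 relation symbols. Terms are generated by morphisms $Y\to X$ of $\mathcal V$ (as $(X,Y)$-ary terms) and function symbols under powers $t^Z$, tupling and composition; an $(X,Y)$-ary term $t$ is interpreted as $t_A\colon A^X\to A^Y$. Formulas $\varphi$ of arity $X$ are interpreted as $\mathcal M$-subobjects $\varphi_A\rightarrowtail A^X$: $s=t$ as the $\mathcal M$-part of the $(\mathcal E,\mathcal M)$-factorization of the equalizer of $s_A,t_A$; $R^Y(t)$ as the pullback of $R_A^Y$ along $t_A$; conjunctions as intersections; $(\exists y)\psi(x,y)$, with $\psi$ of arity $X+Y$, as the $\mathcal M$-part of $\psi_A\to A^{X+Y}\to A^X$; disjunctions as the $\mathcal M$-part of $\sum_j(\varphi_j)_A\to A^X$. A formula is positive-primitive if it is $(\exists y)\bigwedge_j\varphi_j$ with all $\varphi_j$ atomic, and positive-existential if it is a disjunction of positive-primitive formulas; it is in $\mathbb L_{\lambda\lambda}$ if all arities involved are $\lambda$-presentable and its conjunctions and disjunctions have fewer than $\lambda$ members. A basic theory $\mathbb T$ in $\mathbb L_{\lambda\lambda}$ is a set of sequents $\varphi\vdash\psi$ between positive-existential formulas in $\mathbb L_{\lambda\lambda}$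 of the same arity, and $\mathrm{Mod}(\mathbb T)$ is the full subcategory of $\mathbf{Str}(\mathbb L)$ on those $A$ with $\varphi_A\subseteq\psi_A$ for every sequent in $\mathbb T$. A morphism $f\colon K\to N$ of $\mathbb L$-structures is $\lambda$-elementary if for every positive-primitive $\psi$ in $\mathbb L_{\lambda\lambda}$, of arity $X$, the square with sides $\psi_K\to\psi_N$, $\psi_K\rightarrowtail K^X$, $\psi_N\rightarrowtail N^X$ and $f^X$ is a pullback. Say that $\lambda$-elementary morphisms are $\lambda$-p.e. stable if, for every $\lambda$-elementary morphism of $\mathbb L$-structures, the same holds for all positive-existential $\psi$ in $\mathbb L_{\lambda\lambda}$. An object $X$ of $\mathcal V$ is $\mathcal E$-stable if $e^X\in\mathcal E$ for all $e\in\mathcal E$, and $\mathcal V$-connected if $(-)^X$ preserves coproducts. **Proposition.** For every basic theory $\mathbb T$ in $\mathbb L_{\lambda\lambda}$: 1. $\mathrm{Mod}(\mathbb T)$ is closed in $\mathbf{Str}(\mathbb L)$ under $\lambda$-directed colimits; 2. if $\lambda$-elementary morphisms are $\lambda$-p.e. stable, then $\mathrm{Mod}(\mathbb T)$ is closed under $\lambda$-elementary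 subobjects: if $f\colon K\to N$ is $\lambda$-elementary and $N\in\mathrm{Mod}(\mathbb T)$, then $K\in\mathrm{Mod}(\mathbb T)$; 3. $\mathrm{Mod}(\mathbb T)$ is closed in the $\mathcal V$-category $\mathbf{Str}(\mathbb L)$ under powers by $\mathcal E$-stable $\mathcal V$-connected objects $X$ of $\mathcal V$. -/

import Mathlib

open CategoryTheory CategoryTheory.Limits CategoryTheory.MonoidalCategory

universe w u

namespace EnrichedLogic

noncomputable section

/-- A locally presentable category has all small limits. -/
theorem hasLimits_of_isCardinalLocallyPresentable (V : Type u) [Category.{w} V]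
    (κ : Cardinal.{w}) [Fact κ.IsRegular] [IsCardinalLocallyPresentable V κ] : HasLimits V := by
  let P := isCardinalPresentable V κ
  let F : SmallModel.{w} P.FullSubcategory ⥤ V :=
    (equivSmallModel.{w} P.FullSubcategory).inverse ⋙ P.ι
  have : F.IsDense := inferInstance
  have : (uliftYoneda.{w}).HasPointwiseLeftKanExtension F := inferInstance
  let adj := Presheaf.uliftYonedaAdjunction.{w} _ (uliftYoneda.{w}.leftKanExtensionUnit F)
  let _ : Reflective (Presheaf.restrictedULiftYoneda.{w} F) := { L := _, adj := adj }
  exact hasLimits_of_reflective (Presheaf.restrictedULiftYoneda.{w} F)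

section Base

variable (V : Type u) [Category.{w} V] [MonoidalCategory V]

/-- An enriched factorization system `(E, M)` on a monoidal closed category whose right class
consists of monomorphisms: an orthogonal factorization system (both classes contain the
isomorphisms and are closed under composition, every morphism factors, unique diagonal fill-in)
such that `E` is closed under tensoring with objects. -/
structure FactorizationSystem where
  /-- the left class -/
  E : MorphismProperty V
  /-- the right class -/
  M : MorphismProperty V
  E_of_isIso : ∀ {A B : V} (f : A ⟶ B), IsIso f → E f
  M_of_isIso : ∀ {A B : V} (f : A ⟶ B), IsIso f → M f
  E_comp : ∀ {A B C : V} (f : A ⟶ B) (g : B ⟶ C), E f → E g → E (f ≫ g)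
  M_comp : ∀ {A B C : V} (f : A ⟶ B) (g : B ⟶ C), M f → M g → M (f ≫ g)
  exists_factorization : ∀ {A B : V} (f : A ⟶ B),
    ∃ (C : V) (e : A ⟶ C) (m : C ⟶ B), E e ∧ M m ∧ e ≫ m = f
  existsUnique_lift : ∀ {A B C D : V} (e : A ⟶ B) (m : C ⟶ D), E e → M m →
    ∀ (f : A ⟶ C) (g : B ⟶ D), f ≫ m = e ≫ g → ∃! d : B ⟶ C, e ≫ d = f ∧ d ≫ m = g
  E_tensor : ∀ {A B : V} (e : A ⟶ B), E e → ∀ Z : V, E (Z ◁ e)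
  mono_of_M : ∀ {A B : V} (m : A ⟶ B), M m → Mono m

/-- A (single-sorted) language over `V`: function symbols `f : (X, Y)` and relation symbols
`R : X`, with arities objects of `V`. -/
structure Language where
  /-- the set of function symbols -/
  Fun : Type w
  /-- the set of relation symbols -/
  Rel : Type w
  /-- the input arity of a function symbol -/
  dom : Fun → V
  /-- the output arity of a function symbol -/
  cod : Fun → V
  /-- the arity of a relation symbol -/
  ar : Rel → V

variable {V}

/-- A language is `κ`-ary if all its arities are `κ`-presentable. -/
def Language.IsAry (L : Language.{w} V) (κ : Cardinal.{w}) [Fact κ.IsRegular] : Prop :=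
  (∀ f, IsCardinalPresentable (L.dom f) κ) ∧ (∀ f, IsCardinalPresentable (L.cod f) κ) ∧
    ∀ R, IsCardinalPresentable (L.ar R) κ

/-- The subobject of `B` given by the right part of the `(E, M)`-factorization of `f`. -/
def FactorizationSystem.image (F : FactorizationSystem V) {A B : V} (f : A ⟶ B) : Subobject B :=
  haveI : Mono (F.exists_factorization f).choose_spec.choose_spec.choose :=
    F.mono_of_M _ (F.exists_factorization f).choose_spec.choose_spec.choose_spec.2.1
  Subobject.mk (F.exists_factorization f).choose_spec.choose_spec.choose

/-- `M` is closed in the category of arrows of `V` under `κ`-directed colimits. -/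
def FactorizationSystem.IsClosedUnderDirectedColimits (F : FactorizationSystem V)
    (κ : Cardinal.{w}) [Fact κ.IsRegular] : Prop :=
  ∀ (J : Type w) [PartialOrder J] [IsCardinalFiltered J κ], F.M.IsStableUnderColimitsOfShape J

variable [MonoidalClosed V]

/-- `X` is `E`-stable: `e ^ X : A ^ X ⟶ B ^ X` is in `E` whenever `e : A ⟶ B` is. -/
def FactorizationSystem.IsStable (F : FactorizationSystem V) (X : V) : Prop :=
  ∀ {A B : V} (e : A ⟶ B), F.E e → F.E ((ihom X).map e)

/-- `X` is `V`-connected: `(-) ^ X = [X, -]` preserves (small) coproducts. -/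
def IsVConnected (X : V) : Prop :=
  ∀ J : Type w, PreservesColimitsOfShape (Discrete J) (ihom X)

/-- The canonical isomorphism `A ^ (X ⊗ Y) ≅ (A ^ X) ^ Y`. -/
def ihomTensorIso (X Y A : V) : (ihom (X ⊗ Y)).obj A ≅ (ihom Y).obj ((ihom X).obj A) where
  hom := MonoidalClosed.curry (MonoidalClosed.curry
    ((α_ X Y _).inv ≫ (ihom.ev (X ⊗ Y)).app A))
  inv := MonoidalClosed.curry ((α_ X Y _).hom ≫ MonoidalClosed.uncurry
    ((ihom.ev Y).app ((ihom X).obj A)))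
  hom_inv_id := by
    apply MonoidalClosed.uncurry_injective
    rw [MonoidalClosed.uncurry_natural_left, MonoidalClosed.uncurry_curry,
      associator_naturality_right_assoc, ← MonoidalClosed.uncurry_natural_left,
      ← MonoidalClosed.uncurry_eq, MonoidalClosed.uncurry_curry, MonoidalClosed.uncurry_curry,
      Iso.hom_inv_id_assoc, MonoidalClosed.uncurry_id_eq_ev]
  inv_hom_id := by
    apply MonoidalClosed.uncurry_injective
    apply MonoidalClosed.uncurry_injective
    rw [MonoidalClosed.uncurry_natural_left, MonoidalClosed.uncurry_natural_left,
      MonoidalClosed.uncurry_curry, MonoidalClosed.uncurry_curry,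
      associator_inv_naturality_right_assoc, ← MonoidalClosed.uncurry_eq,
      MonoidalClosed.uncurry_curry, Iso.inv_hom_id_assoc, MonoidalClosed.uncurry_id_eq_ev]

end Base

section Formulas

variable {V : Type u} [Category.{w} V] [MonoidalCategory V] [HasColimits V]

/-- The `(X, Y)`-ary (extended) terms of a language, generated by the morphisms `Y ⟶ X` of `V` and
the function symbols, under powers, tupling and composition. -/
inductive Term (L : Language.{w} V) : V → V → Type (max u (w + 1))
  | ofHom {X Y : V} (f : Y ⟶ X) : Term L X Y
  | symb (f : L.Fun) : Term L (L.dom f) (L.cod f)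
  | pow {X Y : V} (t : Term L X Y) (Z : V) : Term L (X ⊗ Z) (Y ⊗ Z)
  | tuple {X : V} {J : Type w} (Y : J → V) (t : ∀ j, Term L X (Y j)) : Term L X (∐ Y)
  | comp {X Y Z : V} (t : Term L X Y) (s : Term L Y Z) : Term L X Z

/-- The formulas of a language, indexed by their arity. -/
inductive Formula (L : Language.{w} V) : V → Type (max u (w + 1))
  /-- `s(x) = t(x)` -/
  | eq {X Y : V} (s t : Term L X Y) : Formula L X
  /-- `R ^ Y (t(z))` -/
  | rel (R : L.Rel) (Y : V) {Z : V} (t : Term L Z (L.ar R ⊗ Y)) : Formula L Z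
  /-- `⋀ j, φ j` -/
  | conj {X : V} {J : Type w} (φ : J → Formula L X) : Formula L X
  /-- `(∃ y) ψ(x, y)` -/
  | ex {X : V} (Y : V) (ψ : Formula L (X ⨿ Y)) : Formula L X
  /-- `⋁ j, φ j` -/
  | disj {X : V} {J : Type w} (φ : J → Formula L X) : Formula L X

variable {L : Language.{w} V}

/-- All arities involved in a term are `κ`-presentable, and all tuples have fewer than `κ`
entries. -/
def Term.IsAry (κ : Cardinal.{w}) [Fact κ.IsRegular] : ∀ {X Y : V}, Term L X Y → Prop
  | X, Y, .ofHom _ => IsCardinalPresentable X κ ∧ IsCardinalPresentable Y κ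
  | _, _, .symb f => IsCardinalPresentable (L.dom f) κ ∧ IsCardinalPresentable (L.cod f) κ
  | _, _, .pow t Z => t.IsAry κ ∧ IsCardinalPresentable Z κ
  | X, _, .tuple (J := J) _ t =>
      IsCardinalPresentable X κ ∧ HasCardinalLT J κ ∧ ∀ j, (t j).IsAry κ
  | _, _, .comp t s => t.IsAry κ ∧ s.IsAry κ

/-- The formulas of `𝕃_{κκ}`: all arities involved are `κ`-presentable, and all conjunctions and
disjunctions have fewer than `κ` members. -/
def Formula.IsAry (κ : Cardinal.{w}) [Fact κ.IsRegular] : ∀ {X : V}, Formula L X → Prop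
  | _, .eq s t => s.IsAry κ ∧ t.IsAry κ
  | _, .rel R Y t => IsCardinalPresentable (L.ar R) κ ∧ IsCardinalPresentable Y κ ∧ t.IsAry κ
  | X, .conj (J := J) φ => IsCardinalPresentable X κ ∧ HasCardinalLT J κ ∧ ∀ j, (φ j).IsAry κ
  | X, .ex Y ψ => IsCardinalPresentable X κ ∧ IsCardinalPresentable Y κ ∧ ψ.IsAry κ
  | X, .disj (J := J) φ => IsCardinalPresentable X κ ∧ HasCardinalLT J κ ∧ ∀ j, (φ j).IsAry κ

/-- Atomic formulas. -/
inductive Formula.IsAtomic : ∀ {X : V}, Formula L X → Prop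
  | eq {X Y : V} (s t : Term L X Y) : IsAtomic (.eq s t)
  | rel (R : L.Rel) (Y : V) {Z : V} (t : Term L Z (L.ar R ⊗ Y)) : IsAtomic (.rel R Y t)

/-- Positive-primitive formulas: `(∃ y) ⋀ j, φ j` with all `φ j` atomic. -/
def Formula.IsPositivePrimitive {X : V} (φ : Formula L X) : Prop :=
  ∃ (Y : V) (J : Type w) (ψ : J → Formula L (X ⨿ Y)),
    (∀ j, (ψ j).IsAtomic) ∧ φ = .ex Y (.conj ψ)

/-- Positive-existential formulas: `⋁ j, φ j` with all `φ j` positive-primitive. -/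
def Formula.IsPositiveExistential {X : V} (φ : Formula L X) : Prop :=
  ∃ (J : Type w) (ψ : J → Formula L X), (∀ j, (ψ j).IsPositivePrimitive) ∧ φ = .disj ψ

variable (L) in
/-- A sequent `(∀ x) (φ(x) ⊢ ψ(x))`. -/
structure Sequent where
  /-- the arity of `x` -/
  arity : V
  /-- the formula `φ` -/
  lhs : Formula L arity
  /-- the formula `ψ` -/
  rhs : Formula L arity

/-- `T` is a basic theory in `𝕃_{κκ}`: a set of sequents of positive-existential formulas which
are all in `𝕃_{κκ}`. -/
def IsBasicTheory (κ : Cardinal.{w}) [Fact κ.IsRegular] (T : Set (Sequent L)) : Prop :=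
  ∀ σ ∈ T, (σ.lhs.IsPositiveExistential ∧ σ.lhs.IsAry κ) ∧
    (σ.rhs.IsPositiveExistential ∧ σ.rhs.IsAry κ)

end Formulas

section Structures

variable {V : Type u} [Category.{w} V] [MonoidalCategory V] [MonoidalClosed V]

/-- An `𝕃`-structure: an object `A` of `V` with a morphism `f_A : A ^ X ⟶ A ^ Y` for each function
symbol `f : (X, Y)` and an `M`-subobject of `A ^ X` for each relation symbol `R : X`. -/
structure Str (F : FactorizationSystem V) (L : Language.{w} V) where
  /-- the underlying object -/
  carrier : V
  /-- the interpretation of the function symbols -/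
  fn : ∀ f : L.Fun, (ihom (L.dom f)).obj carrier ⟶ (ihom (L.cod f)).obj carrier
  /-- the interpretation of the relation symbols -/
  rel : ∀ R : L.Rel, Subobject ((ihom (L.ar R)).obj carrier)
  rel_mem : ∀ R : L.Rel, F.M (rel R).arrow

variable {F : FactorizationSystem V} {L : Language.{w} V}

namespace Str

/-- A morphism of `𝕃`-structures. -/
@[ext]
structure Hom (A B : Str F L) where
  /-- the underlying morphism of `V` -/
  hom : A.carrier ⟶ B.carrier
  fn_comm : ∀ f : L.Fun, (ihom (L.dom f)).map hom ≫ B.fn f = A.fn f ≫ (ihom (L.cod f)).map hom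
  rel_comm : ∀ R : L.Rel, ∃ k : (A.rel R : V) ⟶ (B.rel R : V),
    k ≫ (B.rel R).arrow = (A.rel R).arrow ≫ (ihom (L.ar R)).map hom

instance : Category (Str F L) where
  Hom := Hom
  id A := ⟨𝟙 _, by simp, fun R => ⟨𝟙 _, by simp⟩⟩
  comp {A B C} f g := ⟨f.hom ≫ g.hom, fun s => by
      rw [Functor.map_comp, Functor.map_comp, Category.assoc, g.fn_comm, ← Category.assoc,
        f.fn_comm, Category.assoc], fun R => by
      obtain ⟨k, hk⟩ := f.rel_comm R
      obtain ⟨l, hl⟩ := g.rel_comm R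
      exact ⟨k ≫ l, by rw [Category.assoc, hl, reassoc_of% hk, Functor.map_comp]⟩⟩
  id_comp f := by ext; exact Category.id_comp f.hom
  comp_id f := by ext; exact Category.comp_id f.hom
  assoc f g h := by ext; exact Category.assoc f.hom g.hom h.hom

end Str

end Structures

section Powers

variable {V : Type u} [Category.{w} V] [MonoidalCategory V] [SymmetricCategory V]

/-- The symmetry `Y ⊗ (Z ⊗ W) ⟶ Z ⊗ (Y ⊗ W)`. -/
def leftSwap (Y Z W : V) : Y ⊗ (Z ⊗ W) ⟶ Z ⊗ (Y ⊗ W) :=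
  (α_ Y Z W).inv ≫ (β_ Y Z).hom ▷ W ≫ (α_ Z Y W).hom

variable [MonoidalClosed V]

/-- For `h : Z ⊗ A ⟶ B`, the induced map `Z ⊗ A ^ Y ⟶ B ^ Y`, sending `(z, a)` to
`y ↦ h (z, a y)`. -/
def powMap {Z A B : V} (Y : V) (h : Z ⊗ A ⟶ B) : Z ⊗ (ihom Y).obj A ⟶ (ihom Y).obj B :=
  MonoidalClosed.curry (leftSwap Y Z _ ≫ Z ◁ (ihom.ev Y).app A ≫ h)

variable {F : FactorizationSystem V} {L : Language.{w} V}

/-- The generalized elements `Z ⟶ Str(𝕃)(A, B)` of the hom-objects of the `V`-category of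
`𝕃`-structures: families `h : Z ⊗ A ⟶ B` of morphisms of structures parametrized by `Z`.
For `Z = 𝟙_ V` these are the morphisms of structures. -/
structure IsFamilyOfHoms {A B : Str F L} (Z : V) (h : Z ⊗ A.carrier ⟶ B.carrier) : Prop where
  fn_comm : ∀ f : L.Fun, powMap (L.dom f) h ≫ B.fn f = Z ◁ A.fn f ≫ powMap (L.cod f) h
  rel_comm : ∀ R : L.Rel, ∃ k : Z ⊗ (A.rel R : V) ⟶ (B.rel R : V),
    k ≫ (B.rel R).arrow = Z ◁ (A.rel R).arrow ≫ powMap (L.ar R) h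

/-- `P` is the power of `A` by `X` in the `V`-category of `𝕃`-structures, with counit
`ε : X ⟶ Str(𝕃)(P, A)`: the induced morphisms `Str(𝕃)(C, P) ⟶ [X, Str(𝕃)(C, A)]` are isomorphisms,
that is, bijective on generalized elements `Z ⟶ Str(𝕃)(C, P)`. -/
structure IsPower (X : V) (A P : Str F L) (ε : X ⊗ P.carrier ⟶ A.carrier) : Prop where
  counit : IsFamilyOfHoms X ε
  existsUnique : ∀ (C : Str F L) (Z : V) (g : (X ⊗ Z) ⊗ C.carrier ⟶ A.carrier),
    IsFamilyOfHoms (X ⊗ Z) g → ∃! h : Z ⊗ C.carrier ⟶ P.carrier,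
      IsFamilyOfHoms Z h ∧ (α_ X Z C.carrier).hom ≫ X ◁ h ≫ ε = g

end Powers

section PowersExist

open MonoidalClosed

variable {V : Type u} [Category.{w} V] [MonoidalCategory V]

theorem FactorizationSystem.M_of_lift (F : FactorizationSystem V) {C D : V} (m : C ⟶ D)
    (H : ∀ {A B : V} (e : A ⟶ B), F.E e → ∀ (f : A ⟶ C) (g : B ⟶ D), f ≫ m = e ≫ g →
      ∃ d : B ⟶ C, e ≫ d = f ∧ d ≫ m = g) : F.M m := by
  obtain ⟨B, e, n, he, hn, rfl⟩ := F.exists_factorization m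
  obtain ⟨d, hd, hd'⟩ := H e he (𝟙 C) n (by simp)
  have hde : d ≫ e = 𝟙 B := by
    have := F.mono_of_M n hn
    rw [← cancel_mono n, Category.assoc, hd', Category.id_comp]
  exact F.M_comp _ _ (F.M_of_isIso _ ⟨d, hd, hde⟩) hn

theorem FactorizationSystem.M_ihom [MonoidalClosed V] (F : FactorizationSystem V) {C D : V}
    (m : C ⟶ D) (hm : F.M m) (X : V) : F.M ((ihom X).map m) := by
  refine F.M_of_lift _ fun {A B} e he f g hfg => ?_
  obtain ⟨d, ⟨h1, h2⟩, -⟩ := F.existsUnique_lift (X ◁ e) m (F.E_tensor e he X) hm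
    (uncurry f) (uncurry g) (by rw [← uncurry_natural_right, hfg, uncurry_natural_left])
  refine ⟨curry d, ?_, ?_⟩
  · rw [← curry_natural_left, h1, curry_uncurry]
  · rw [← curry_natural_right, h2, curry_uncurry]

variable [SymmetricCategory V]

theorem leftSwap_leftSwap (X Y W : V) : leftSwap X Y W ≫ leftSwap Y X W = 𝟙 _ := by
  simp [leftSwap, ← comp_whiskerRight_assoc]

theorem leftSwap_leftSwap_assoc (X Y W : V) {U : V} (g : X ⊗ (Y ⊗ W) ⟶ U) :
    leftSwap X Y W ≫ leftSwap Y X W ≫ g = g := by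
  rw [← Category.assoc, leftSwap_leftSwap, Category.id_comp]

theorem leftSwap_natural (X Y : V) {W W' : V} (k : W ⟶ W') :
    X ◁ Y ◁ k ≫ leftSwap X Y W' = leftSwap X Y W ≫ Y ◁ X ◁ k := by
  simp only [leftSwap, Category.assoc]
  rw [associator_inv_naturality_right_assoc, whisker_exchange_assoc, tensor_whiskerLeft]
  simp

theorem leftSwap_natural_assoc (X Y : V) {W W' U : V} (k : W ⟶ W')
    (g : Y ⊗ (X ⊗ W') ⟶ U) :
    X ◁ Y ◁ k ≫ leftSwap X Y W' ≫ g = leftSwap X Y W ≫ Y ◁ X ◁ k ≫ g := by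
  rw [← Category.assoc, leftSwap_natural, Category.assoc]

theorem leftSwap_tensor (Y X Z W : V) :
    leftSwap Y (X ⊗ Z) W ≫ (α_ X Z (Y ⊗ W)).hom =
      Y ◁ (α_ X Z W).hom ≫ leftSwap Y X (Z ⊗ W) ≫ X ◁ leftSwap Y Z W := by
  simp [leftSwap]

theorem leftSwap_tensor_assoc (Y X Z W : V) {U : V} (g : X ⊗ (Z ⊗ (Y ⊗ W)) ⟶ U) :
    leftSwap Y (X ⊗ Z) W ≫ (α_ X Z (Y ⊗ W)).hom ≫ g =
      Y ◁ (α_ X Z W).hom ≫ leftSwap Y X (Z ⊗ W) ≫ X ◁ leftSwap Y Z W ≫ g := by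
  rw [← Category.assoc, leftSwap_tensor, Category.assoc, Category.assoc]

variable [MonoidalClosed V]

theorem uncurry_powMap {Z A B : V} (Y : V) (h : Z ⊗ A ⟶ B) :
    uncurry (powMap Y h) = leftSwap Y Z _ ≫ Z ◁ (ihom.ev Y).app A ≫ h := by
  simp [powMap]

/-- The symmetry `(A ^ X) ^ Y ⟶ (A ^ Y) ^ X`. -/
def ihomSwap (X Y A : V) : (ihom Y).obj ((ihom X).obj A) ⟶ (ihom X).obj ((ihom Y).obj A) :=
  curry (powMap Y ((ihom.ev X).app A))

theorem uncurry_ihomSwap (X Y A : V) :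
    uncurry (ihomSwap X Y A) = powMap Y ((ihom.ev X).app A) := by
  simp [ihomSwap]

theorem uncurry_uncurry_ihomSwap (X Y A : V) :
    uncurry (uncurry (ihomSwap X Y A)) =
      leftSwap Y X _ ≫ X ◁ (ihom.ev Y).app _ ≫ (ihom.ev X).app A := by
  rw [uncurry_ihomSwap, uncurry_powMap]

theorem ihomSwap_ihomSwap (X Y A : V) : ihomSwap X Y A ≫ ihomSwap Y X A = 𝟙 _ := by
  apply uncurry_injective
  apply uncurry_injective
  rw [uncurry_natural_left, uncurry_natural_left, uncurry_uncurry_ihomSwap,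
    leftSwap_natural_assoc, ← MonoidalCategory.whiskerLeft_comp_assoc, ← uncurry_eq,
    ← uncurry_eq, uncurry_uncurry_ihomSwap, leftSwap_leftSwap_assoc, uncurry_id_eq_ev,
    uncurry_eq]

/-- The symmetry `ihomSwap` as an isomorphism. -/
@[simps]
def ihomSwapIso (X Y A : V) :
    (ihom Y).obj ((ihom X).obj A) ≅ (ihom X).obj ((ihom Y).obj A) where
  hom := ihomSwap X Y A
  inv := ihomSwap Y X A
  hom_inv_id := ihomSwap_ihomSwap X Y A
  inv_hom_id := ihomSwap_ihomSwap Y X A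

theorem powMap_uncurry {X Z C A : V} (Y : V) (h : Z ⊗ C ⟶ (ihom X).obj A) :
    powMap Y ((α_ X Z C).hom ≫ uncurry h) =
      (α_ X Z _).hom ≫ uncurry (powMap Y h ≫ ihomSwap X Y A) := by
  apply uncurry_injective
  rw [uncurry_powMap, uncurry_natural_left, uncurry_natural_left, uncurry_natural_left,
    uncurry_uncurry_ihomSwap, leftSwap_natural_assoc, ← MonoidalCategory.whiskerLeft_comp_assoc,
    ← uncurry_eq (powMap Y h), uncurry_powMap]
  simp only [MonoidalCategory.whiskerLeft_comp, Category.assoc, uncurry_eq,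
    ← leftSwap_tensor_assoc]
  simp

theorem powMap_fn_iff {X Z C A D D' : V} (h : Z ⊗ C ⟶ (ihom X).obj A)
    (c : (ihom D).obj C ⟶ (ihom D').obj C) (a : (ihom D).obj A ⟶ (ihom D').obj A) :
    powMap D h ≫ ihomSwap X D A ≫ (ihom X).map a ≫ ihomSwap D' X A = Z ◁ c ≫ powMap D' h ↔
      powMap D ((α_ X Z C).hom ≫ uncurry h) ≫ a =
        (X ⊗ Z) ◁ c ≫ powMap D' ((α_ X Z C).hom ≫ uncurry h) := by
  rw [powMap_uncurry, powMap_uncurry, Category.assoc, ← uncurry_natural_right,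
    tensor_whiskerLeft, Category.assoc, Category.assoc, Category.assoc, Iso.inv_hom_id_assoc,
    cancel_epi,
    ← uncurry_natural_left, uncurry_injective.eq_iff, ← cancel_mono (ihomSwapIso X D' A).hom]
  simp [ihomSwap_ihomSwap]

theorem mk_arrow_ihomSwap {X A D R : V} (a : R ⟶ (ihom D).obj A)
    [Mono ((ihom X).map a ≫ ihomSwap D X A)] :
    (Subobject.mk ((ihom X).map a ≫ ihomSwap D X A)).arrow ≫ ihomSwap X D A =
      (Subobject.underlyingIso ((ihom X).map a ≫ ihomSwap D X A)).hom ≫ (ihom X).map a := by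
  rw [← Iso.inv_comp_eq, Subobject.underlyingIso_arrow_assoc, Category.assoc,
    ihomSwap_ihomSwap, Category.comp_id]

theorem powMap_rel_iff {X Z C A D R S : V} (h : Z ⊗ C ⟶ (ihom X).obj A)
    (c : S ⟶ (ihom D).obj C) (a : R ⟶ (ihom D).obj A)
    [Mono ((ihom X).map a ≫ ihomSwap D X A)] :
    (∃ k : Z ⊗ S ⟶ (Subobject.mk ((ihom X).map a ≫ ihomSwap D X A) : V),
      k ≫ (Subobject.mk ((ihom X).map a ≫ ihomSwap D X A)).arrow = Z ◁ c ≫ powMap D h) ↔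
    ∃ k : (X ⊗ Z) ⊗ S ⟶ R,
      k ≫ a = (X ⊗ Z) ◁ c ≫ powMap D ((α_ X Z C).hom ≫ uncurry h) := by
  rw [powMap_uncurry, tensor_whiskerLeft, Category.assoc, Category.assoc,
    Iso.inv_hom_id_assoc, ← uncurry_natural_left]
  constructor
  · rintro ⟨k, hk⟩
    refine ⟨(α_ X Z S).hom ≫ uncurry (k ≫ (Subobject.underlyingIso _).hom), ?_⟩
    rw [Category.assoc, ← uncurry_natural_right, ← Category.assoc (Z ◁ c), ← hk]
    simp [mk_arrow_ihomSwap]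
  · rintro ⟨k, hk⟩
    refine ⟨curry ((α_ X Z S).inv ≫ k) ≫ (Subobject.underlyingIso _).inv, ?_⟩
    rw [Category.assoc, Subobject.underlyingIso_arrow, ← Category.assoc,
      ← curry_natural_right, Category.assoc, hk, Iso.inv_hom_id_assoc, curry_uncurry]
    simp [ihomSwap_ihomSwap]


variable {F : FactorizationSystem V} {L : Language.{w} V}

/-- The power of a structure, computed in `V`. -/
def Str.power (A : Str F L) (X : V) : Str F L where
  carrier := (ihom X).obj A.carrier
  fn f := ihomSwap X _ _ ≫ (ihom X).map (A.fn f) ≫ ihomSwap _ X _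
  rel R :=
    haveI : Mono (ihomSwap (L.ar R) X A.carrier) :=
      inferInstanceAs (Mono (ihomSwapIso (L.ar R) X A.carrier).hom)
    Subobject.mk ((ihom X).map (A.rel R).arrow ≫ ihomSwap (L.ar R) X A.carrier)
  rel_mem R := by
    have : IsIso (ihomSwap (L.ar R) X A.carrier) :=
      inferInstanceAs (IsIso (ihomSwapIso (L.ar R) X A.carrier).hom)
    rw [← Subobject.underlyingIso_hom_comp_eq_mk]
    exact F.M_comp _ _ (F.M_of_isIso _ inferInstance)
      (F.M_comp _ _ (F.M_ihom _ (A.rel_mem R) X) (F.M_of_isIso _ inferInstance))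

theorem isFamilyOfHoms_power_iff (A C : Str F L) (X Z : V)
    (h : Z ⊗ C.carrier ⟶ (ihom X).obj A.carrier) :
    IsFamilyOfHoms (A := C) (B := A.power X) Z h ↔
      IsFamilyOfHoms (A := C) (B := A) (X ⊗ Z) ((α_ X Z C.carrier).hom ≫ uncurry h) := by
  have hm (R) : Mono (ihomSwap (L.ar R) X A.carrier) :=
    inferInstanceAs (Mono (ihomSwapIso (L.ar R) X A.carrier).hom)
  exact ⟨fun H => ⟨fun f => (powMap_fn_iff h _ _).1 (H.fn_comm f),
      fun R => (powMap_rel_iff h _ _).1 (H.rel_comm R)⟩,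
    fun H => ⟨fun f => (powMap_fn_iff h _ _).2 (H.fn_comm f),
      fun R => (powMap_rel_iff h _ _).2 (H.rel_comm R)⟩⟩

theorem isFamilyOfHoms_ev (A : Str F L) (X : V) :
    IsFamilyOfHoms (A := A.power X) (B := A) X ((ihom.ev X).app A.carrier) := by
  have hm (R) : Mono (ihomSwap (L.ar R) X A.carrier) :=
    inferInstanceAs (Mono (ihomSwapIso (L.ar R) X A.carrier).hom)
  have h1 (D D' : V) (a : (ihom D).obj A.carrier ⟶ (ihom D').obj A.carrier) :
      powMap D ((ihom.ev X).app A.carrier) ≫ a =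
        X ◁ (ihomSwap X D A.carrier ≫ (ihom X).map a ≫ ihomSwap D' X A.carrier) ≫
          powMap D' ((ihom.ev X).app A.carrier) := by
    rw [← uncurry_ihomSwap, ← uncurry_ihomSwap, ← uncurry_natural_right, ← uncurry_natural_left]
    simp [ihomSwap_ihomSwap]
  have h2 (D R : V) (a : R ⟶ (ihom D).obj A.carrier)
      [Mono ((ihom X).map a ≫ ihomSwap D X A.carrier)] :
      uncurry (Subobject.underlyingIso ((ihom X).map a ≫ ihomSwap D X A.carrier)).hom ≫ a =
        X ◁ (Subobject.mk ((ihom X).map a ≫ ihomSwap D X A.carrier)).arrow ≫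
          powMap D ((ihom.ev X).app A.carrier) := by
    rw [← uncurry_ihomSwap, ← uncurry_natural_right, ← uncurry_natural_left,
      mk_arrow_ihomSwap]
  exact ⟨fun f => h1 _ _ _, fun R => ⟨_, h2 _ _ _⟩⟩

/-- Powers of structures exist and are computed in `V`. -/
theorem isPower_power (A : Str F L) (X : V) :
    IsPower X A (A.power X) ((ihom.ev X).app A.carrier) := by
  refine ⟨isFamilyOfHoms_ev A X, fun C Z g hg => ?_⟩
  have key : ∀ h : Z ⊗ C.carrier ⟶ (ihom X).obj A.carrier,
      (α_ X Z C.carrier).hom ≫ uncurry h = g ↔ h = curry ((α_ X Z C.carrier).inv ≫ g) := by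
    intro h
    rw [← Iso.eq_inv_comp, eq_curry_iff]
  refine ⟨curry ((α_ X Z C.carrier).inv ≫ g), ⟨?_, (key _).2 rfl⟩, fun h hh => (key h).1 hh.2⟩
  exact (isFamilyOfHoms_power_iff A C X Z _).2 (by rwa [(key _).2 rfl])


end PowersExist

section Semantics

variable {V : Type u} [Category.{w} V] [MonoidalCategory V] [SymmetricCategory V]
  [MonoidalClosed V] [HasColimits V]

/-- The morphism `W ⟶ A ^ (∐ Y)` induced by morphisms `W ⟶ A ^ (Y j)`. -/
def ihomTuple {W A : V} {J : Type w} (Y : J → V) (k : ∀ j, W ⟶ (ihom (Y j)).obj A) :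
    W ⟶ (ihom (∐ Y)).obj A :=
  MonoidalClosed.curry ((β_ (∐ Y) W).hom ≫ MonoidalClosed.uncurry
    (Sigma.desc fun j => MonoidalClosed.curry ((β_ W (Y j)).hom ≫ MonoidalClosed.uncurry (k j))))

variable {F : FactorizationSystem V} {L : Language.{w} V}

/-- The interpretation `t_A : A ^ X ⟶ A ^ Y` of an `(X, Y)`-ary term. -/
def Str.term (A : Str F L) : ∀ {X Y : V}, Term L X Y →
    ((ihom X).obj A.carrier ⟶ (ihom Y).obj A.carrier)
  | _, _, .ofHom f => (MonoidalClosed.pre f).app A.carrier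
  | _, _, .symb f => A.fn f
  | _, _, .pow (X := X) (Y := Y) t Z =>
      (ihomTensorIso X Z A.carrier).hom ≫ (ihom Z).map (A.term t) ≫
        (ihomTensorIso Y Z A.carrier).inv
  | _, _, .tuple Y t => ihomTuple Y fun j => A.term (t j)
  | _, _, .comp t s => A.term t ≫ A.term s

/-- The intersection (wide pullback) of a family of subobjects. -/
def inter [HasLimits V] {B : V} {J : Type w} (S : J → Subobject B) : Subobject B :=
  haveI : Mono (WidePullback.base fun j => (S j).arrow) :=
    ⟨fun g h hgh => WidePullback.hom_ext _ _ _
      (fun j => by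
        rw [← cancel_mono (S j).arrow, Category.assoc, Category.assoc, WidePullback.π_arrow, hgh])
      hgh⟩
  Subobject.mk (WidePullback.base fun j => (S j).arrow)

/-- The interpretation `φ_A` of an `X`-ary formula, as an `M`-subobject of `A ^ X`. -/
def Str.interp [HasLimits V] (A : Str F L) :
    ∀ {X : V}, Formula L X → Subobject ((ihom X).obj A.carrier)
  | _, .eq s t => F.image (equalizer.ι (A.term s) (A.term t))
  | _, .rel R Y t => (Subobject.pullback (A.term t ≫ (ihomTensorIso (L.ar R) Y A.carrier).hom)).obj
      (Subobject.mk ((ihom Y).map (A.rel R).arrow))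
  | _, .conj φ => inter fun j => A.interp (φ j)
  | X, .ex Y ψ => F.image ((A.interp ψ).arrow ≫
      (MonoidalClosed.pre (coprod.inl : X ⟶ X ⨿ Y)).app A.carrier)
  | _, .disj φ => F.image (Sigma.desc fun j => (A.interp (φ j)).arrow)

variable [HasLimits V]

/-- The full subcategory `Mod(T)` of the structures satisfying all the sequents in `T`. -/
def Mod (F : FactorizationSystem V) (T : Set (Sequent L)) : ObjectProperty (Str F L) :=
  fun A => ∀ σ ∈ T, A.interp σ.lhs ≤ A.interp σ.rhs

/-- The square formed by `ψ_K`, `ψ_N`, `K ^ X` and `N ^ X` is a pullback. -/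
def IsElementaryFor {K N : Str F L} (f : K ⟶ N) {X : V} (ψ : Formula L X) : Prop :=
  ∃ g : (K.interp ψ : V) ⟶ (N.interp ψ : V),
    IsPullback g (K.interp ψ).arrow (N.interp ψ).arrow ((ihom X).map f.hom)

/-- `f` is `κ`-elementary. -/
def IsElementary (κ : Cardinal.{w}) [Fact κ.IsRegular] {K N : Str F L} (f : K ⟶ N) : Prop :=
  ∀ {X : V} (ψ : Formula L X), ψ.IsPositivePrimitive → ψ.IsAry κ → IsElementaryFor f ψ

/-- `κ`-elementary morphisms of `𝕃`-structures are `κ`-positive-existentially stable. -/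
def ElementaryIsPEStable (κ : Cardinal.{w}) [Fact κ.IsRegular] (F : FactorizationSystem V)
    (L : Language.{w} V) : Prop :=
  ∀ {K N : Str F L} (f : K ⟶ N), IsElementary κ f →
    ∀ {X : V} (ψ : Formula L X), ψ.IsPositiveExistential → ψ.IsAry κ → IsElementaryFor f ψ

end Semantics

end

end EnrichedLogic

/-! For a fixed formula `φ`, the assignment sending `A` to `φ_A` is a functor from structures to
`V`, with a natural monomorphism to `A ^ X` (`Str.interp_factors_map`, `interpFunctor`). Each
closure property comes from a compatibility of this functor.

Directed colimits: the arities are `κ`-presentable and closed under tensor, so powers by them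
preserve `κ`-filtered colimits. Since `M` is closed under these colimits too, colimits of structures
are computed in `V`, relations included (`exists_isColimit_str`). Induction on `φ` then shows that
`φ_A` is preserved (`nonempty_isColimit_interp`): equalizers, pullbacks of subobjects and
intersections of fewer than `κ` subobjects commute with `κ`-filtered colimits, coproducts with all
colimits, and `M`-images by `FactorizationSystem.isColimitOfFactorization`. For a sequent `φ ⊢ ψ`
and a colimit `A` of models `A_j`, the maps from `φ_{A_j}` through `ψ_{A_j}` to `ψ_A` glue to an
inclusion of `φ_A` in `ψ_A`.

Elementary subobjects: `φ_K` maps to `φ_N`, which lies in `ψ_N`. The pullback square for `ψ` turns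
this into a factorization of `φ_K` through `ψ_K` (`Mod.of_isElementaryFor`). Stability supplies that
square for positive-existential `ψ`.

Powers: under the symmetry between `(A ^ X) ^ Y` and `(A ^ Y) ^ X`, the interpretation of `φ` in `A
^ X` is the power of `φ_A` (`Str.IsPowerAlong.interp`). As a right adjoint, the power by `X`
respects equalizers, pullbacks and intersections; `E`-stability handles images and connectedness the
coproducts in disjunctions. Powers preserve inclusions, so sequents pass to `A ^ X`. An arbitrary
power is isomorphic to this one, and models are invariant under isomorphism. -/

namespace EnrichedLogic

noncomputable section

/-! ### Filtered colimits detected by presentable objects -/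

section Colimits

variable {V : Type u} [Category.{w} V] (κ : Cardinal.{w}) [Fact κ.IsRegular]
  {J : Type w} [SmallCategory J] [IsCardinalFiltered J κ]

/-- In a locally `κ`-presentable category, a cocone over a `κ`-filtered diagram is colimit as soon
as `κ`-presentable objects see it as a colimit. -/
theorem nonempty_isColimit_of_isCardinalPresentable [IsCardinalLocallyPresentable V κ]
    {D : J ⥤ V} (c : Cocone D)
    (hsurj : ∀ (Z : V), IsCardinalPresentable Z κ → ∀ f : Z ⟶ c.pt,
      ∃ (j : J) (l : Z ⟶ D.obj j), l ≫ c.ι.app j = f)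
    (hinj : ∀ (Z : V), IsCardinalPresentable Z κ → ∀ (j : J) (f g : Z ⟶ D.obj j),
      f ≫ c.ι.app j = g ≫ c.ι.app j → ∃ (j' : J) (a : j ⟶ j'), f ≫ D.map a = g ≫ D.map a) :
    Nonempty (IsColimit c) := by
  have hP := (isCardinalFilteredGenerator_isCardinalPresentable V κ).isStrongGenerator
  have hfil := isFiltered_of_isCardinalFiltered J κ
  have h1 : Mono (colimit.desc D c) := by
    refine ⟨fun {W} f g hfg => hP.isSeparating f g fun Z hZ h => ?_⟩
    have : IsCardinalPresentable Z κ := hZ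
    obtain ⟨i, f', hf'⟩ := IsCardinalPresentable.exists_hom_of_isColimit κ (colimit.isColimit D)
      (h ≫ f)
    obtain ⟨j, g', hg'⟩ := IsCardinalPresentable.exists_hom_of_isColimit κ (colimit.isColimit D)
      (h ≫ g)
    simp only [colimit.cocone_x, colimit.cocone_ι] at hf' hg'
    -- The two representatives live at different stages, so they are compared after being moved to a
    -- common one.
    have e : (f' ≫ D.map (IsFiltered.leftToMax i j)) ≫ c.ι.app _ =
        (g' ≫ D.map (IsFiltered.rightToMax i j)) ≫ c.ι.app _ := by
      rw [Category.assoc, Category.assoc, c.w, c.w, ← colimit.ι_desc, reassoc_of% hf', hfg,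
        ← reassoc_of% hg', colimit.ι_desc]
    obtain ⟨k, a, ha⟩ := hinj Z hZ _ _ _ e
    rw [← hf', ← hg', ← colimit.w D (IsFiltered.leftToMax i j), ← colimit.w D a,
      ← colimit.w D (IsFiltered.rightToMax i j), ← colimit.w D a]
    simpa using ha =≫ colimit.ι D k
  -- The `κ`-presentable objects form a strong generator: a monomorphism through which all maps from
  -- them factor is invertible.
  have h2 : IsIso (colimit.desc D c) := by
    refine hP.isIso_of_mono _ fun Z hZ f => ?_
    obtain ⟨j, l, hl⟩ := hsurj Z hZ f
    exact ⟨l ≫ colimit.ι D j, by simpa using hl⟩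
  have h3 : IsIso ((colimit.isColimit D).desc c) := h2
  exact ⟨IsColimit.ofPointIso (colimit.isColimit D)⟩

/-- A cocone of subobjects of a `κ`-filtered diagram is colimit as soon as every morphism from a
`κ`-presentable object which factors through the subobject of the colimit
does so at some stage. -/
theorem nonempty_isColimit_of_mono [IsCardinalLocallyPresentable V κ]
    {D H : J ⥤ V} (m : D ⟶ H) [∀ j, Mono (m.app j)]
    {c : Cocone D} {h : Cocone H} (hh : IsColimit h) (mc : c.pt ⟶ h.pt)
    (comm : ∀ j, c.ι.app j ≫ mc = m.app j ≫ h.ι.app j) [Mono mc]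
    (hsurj : ∀ (Z : V), IsCardinalPresentable Z κ → ∀ (j : J) (l : Z ⟶ H.obj j) (f : Z ⟶ c.pt),
      l ≫ h.ι.app j = f ≫ mc →
        ∃ (j' : J) (a : j ⟶ j') (l' : Z ⟶ D.obj j'), l' ≫ m.app j' = l ≫ H.map a) :
    Nonempty (IsColimit c) := by
  refine nonempty_isColimit_of_isCardinalPresentable κ c (fun Z hZ f => ?_)
    (fun Z hZ j f g hfg => ?_)
  · obtain ⟨j, l, hl⟩ := IsCardinalPresentable.exists_hom_of_isColimit κ hh (f ≫ mc)
    obtain ⟨j', a, l', hl'⟩ := hsurj Z hZ j l f hl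
    refine ⟨j', l', ?_⟩
    rw [← cancel_mono mc, Category.assoc, comm, reassoc_of% hl', h.w, hl]
  -- The equality holds at a later stage of `H`, and descends to `D` because `m` is monic there.
  · obtain ⟨k, a, ha⟩ := IsCardinalPresentable.exists_eq_of_isColimit' κ hh
      (f ≫ m.app j) (g ≫ m.app j) (by
        rw [Category.assoc, Category.assoc, ← comm, reassoc_of% hfg])
    refine ⟨k, a, ?_⟩
    rw [← cancel_mono (m.app k)]
    simpa using ha

/-- Given a morphism `m` of `κ`-filtered diagrams, if the image in the colimit of a morphism from a
`κ`-presentable object factors through the colimit of `m`, then it factors through `m` at some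
stage. -/
theorem exists_factorization_of_isColimit {D H : J ⥤ V} (m : D ⟶ H)
    {c : Cocone D} (hc : IsColimit c) {h : Cocone H} (hh : IsColimit h) (mc : c.pt ⟶ h.pt)
    (comm : ∀ j, c.ι.app j ≫ mc = m.app j ≫ h.ι.app j)
    {Z : V} (hZ : IsCardinalPresentable Z κ) {j : J} (l : Z ⟶ H.obj j) (f : Z ⟶ c.pt)
    (hlf : l ≫ h.ι.app j = f ≫ mc) :
    ∃ (j' : J) (a : j ⟶ j') (l' : Z ⟶ D.obj j'), l' ≫ m.app j' = l ≫ H.map a := by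
  have hfil := isFiltered_of_isCardinalFiltered J κ
  obtain ⟨i, g, rfl⟩ := IsCardinalPresentable.exists_hom_of_isColimit κ hc f
  obtain ⟨k, a, b, hab⟩ := IsCardinalPresentable.exists_eq_of_isColimit κ hh l (g ≫ m.app i)
    (by rw [hlf, Category.assoc, Category.assoc, comm])
  exact ⟨k, a, g ≫ D.map b, by simp [hab]⟩

/-- The internal hom out of a `κ`-presentable object preserves `κ`-filtered colimits. -/
theorem nonempty_isColimit_mapCocone_ihom [IsCardinalLocallyPresentable V κ]
    [MonoidalCategory V] [MonoidalClosed V]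
    (htensor : ∀ X Y : V, IsCardinalPresentable X κ → IsCardinalPresentable Y κ →
      IsCardinalPresentable (X ⊗ Y) κ) {X : V} (hX : IsCardinalPresentable X κ)
    {D : J ⥤ V} {c : Cocone D} (hc : IsColimit c) :
    Nonempty (IsColimit ((ihom X).mapCocone c)) := by
  refine nonempty_isColimit_of_isCardinalPresentable κ _ (fun Z hZ f => ?_)
    (fun Z hZ j f g hfg => ?_)
  · have := htensor X Z hX hZ
    obtain ⟨j, l, hl⟩ := IsCardinalPresentable.exists_hom_of_isColimit κ hc
      (MonoidalClosed.uncurry f)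
    refine ⟨j, MonoidalClosed.curry l, ?_⟩
    apply MonoidalClosed.uncurry_injective
    exact (MonoidalClosed.uncurry_natural_right _ _).trans (by simpa using hl)
  · have := htensor X Z hX hZ
    obtain ⟨k, a, ha⟩ := IsCardinalPresentable.exists_eq_of_isColimit' κ hc
      (MonoidalClosed.uncurry f) (MonoidalClosed.uncurry g) (by
        rw [← MonoidalClosed.uncurry_natural_right, ← MonoidalClosed.uncurry_natural_right]
        exact congrArg _ hfg)
    refine ⟨k, a, MonoidalClosed.uncurry_injective ?_⟩
    exact (MonoidalClosed.uncurry_natural_right _ _).trans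
      (ha.trans (MonoidalClosed.uncurry_natural_right _ _).symm)

end Colimits

/-! ### Subobjects described by the generalized elements that factor through them -/

section Subobjects

variable {V : Type u} [Category.{w} V]

theorem pullback_factors_iff [HasPullbacks V] {B C W : V} (f : B ⟶ C) (S : Subobject C)
    (k : W ⟶ B) : ((Subobject.pullback f).obj S).Factors k ↔ S.Factors (k ≫ f) := by
  have h := Subobject.isPullback f S
  constructor
  · intro hk
    rw [← Subobject.factorThru_arrow _ k hk, Category.assoc, ← h.w, ← Category.assoc]
    exact Subobject.factors_comp_arrow _
  · intro hk
    have := Subobject.factors_comp_arrow (P := (Subobject.pullback f).obj S)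
      (h.lift (S.factorThru _ hk) k (by simp))
    rwa [h.lift_snd] at this

theorem mk_factors_iff_exists {A B W : V} (m : A ⟶ B) [Mono m] (k : W ⟶ B) :
    (Subobject.mk m).Factors k ↔ ∃ l : W ⟶ A, l ≫ m = k :=
  Subobject.mk_factors_iff _ _

theorem inter_factors_iff [HasLimits V] [HasColimits V] {B W : V} {J : Type w}
    (S : J → Subobject B) (k : W ⟶ B) : (inter S).Factors k ↔ ∀ j, (S j).Factors k := by
  have : Mono (WidePullback.base fun j => (S j).arrow) :=
    ⟨fun g h hgh => WidePullback.hom_ext _ _ _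
      (fun j => by
        rw [← cancel_mono (S j).arrow, Category.assoc, Category.assoc, WidePullback.π_arrow, hgh])
      hgh⟩
  refine (mk_factors_iff_exists (WidePullback.base fun j => (S j).arrow) k).trans ⟨?_, ?_⟩
  · rintro ⟨l, rfl⟩ j
    rw [← WidePullback.π_arrow _ j, ← Category.assoc]
    exact Subobject.factors_comp_arrow _
  · exact fun hk => ⟨WidePullback.lift k (fun j => (S j).factorThru k (hk j)) (by simp),
      WidePullback.lift_base _ _ _ _⟩

theorem factors_iff_exists {B W : V} (S : Subobject B) (k : W ⟶ B) :
    S.Factors k ↔ ∃ l : W ⟶ (S : V), l ≫ S.arrow = k := by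
  constructor
  · exact fun h => ⟨_, S.factorThru_arrow k h⟩
  · rintro ⟨l, rfl⟩
    exact Subobject.factors_comp_arrow _

theorem eq_of_factors_iff {B : V} {S T : Subobject B}
    (h : ∀ (W : V) (k : W ⟶ B), S.Factors k ↔ T.Factors k) : S = T :=
  le_antisymm (Subobject.le_of_factors ((h _ _).1 S.factors_self))
    (Subobject.le_of_factors ((h _ _).2 T.factors_self))

end Subobjects

/-! ### Images for the factorization system -/

section Image

variable {V : Type u} [Category.{w} V] [MonoidalCategory V] (F : FactorizationSystem V)

theorem FactorizationSystem.exists_image_eq_mk {A B : V} (f : A ⟶ B) :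
    ∃ (C : V) (e : A ⟶ C) (m : C ⟶ B) (_ : Mono m), F.E e ∧ F.M m ∧ e ≫ m = f ∧
      F.image f = Subobject.mk m := by
  obtain ⟨he, hm, h⟩ := (F.exists_factorization f).choose_spec.choose_spec.choose_spec
  exact ⟨_, _, _, F.mono_of_M _ hm, he, hm, h, rfl⟩

theorem FactorizationSystem.image_eq_mk {A B C : V} (e : A ⟶ C) (m : C ⟶ B) [Mono m]
    (he : F.E e) (hm : F.M m) : F.image (e ≫ m) = Subobject.mk m := by
  obtain ⟨C', e', m', _, he', hm', h, hi⟩ := F.exists_image_eq_mk (e ≫ m)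
  obtain ⟨d, ⟨-, hd⟩, -⟩ := F.existsUnique_lift _ m he' hm e _ h.symm
  obtain ⟨d', ⟨-, hd'⟩, -⟩ := F.existsUnique_lift e _ he hm' _ m h
  rw [hi]
  exact le_antisymm (Subobject.mk_le_mk_of_comm d hd) (Subobject.mk_le_mk_of_comm d' hd')

theorem FactorizationSystem.M_mk_arrow {A B : V} (m : A ⟶ B) [Mono m] (hm : F.M m) :
    F.M (Subobject.mk m).arrow := by
  rw [← Subobject.underlyingIso_hom_comp_eq_mk]
  exact F.M_comp _ _ (F.M_of_isIso _ inferInstance) hm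

theorem FactorizationSystem.exists_image {A B : V} (f : A ⟶ B) :
    ∃ e : A ⟶ (F.image f : V), F.E e ∧ e ≫ (F.image f).arrow = f := by
  obtain ⟨C, e, m, _, he, hm, h, hi⟩ := F.exists_image_eq_mk f
  rw [hi]
  exact ⟨e ≫ (Subobject.underlyingIso m).inv, F.E_comp _ _ he (F.E_of_isIso _ inferInstance),
    by simp [h]⟩

/-- The left part of the factorization of `f` through `F.image f`. -/
def FactorizationSystem.toImage {A B : V} (f : A ⟶ B) : A ⟶ (F.image f : V) :=
  (F.exists_image f).choose

theorem FactorizationSystem.E_toImage {A B : V} (f : A ⟶ B) : F.E (F.toImage f) :=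
  (F.exists_image f).choose_spec.1

theorem FactorizationSystem.toImage_arrow {A B : V} (f : A ⟶ B) :
    F.toImage f ≫ (F.image f).arrow = f :=
  (F.exists_image f).choose_spec.2

theorem FactorizationSystem.M_image_arrow {A B : V} (f : A ⟶ B) : F.M (F.image f).arrow := by
  obtain ⟨C, e, m, _, he, hm, h, hi⟩ := F.exists_image_eq_mk f
  rw [hi]
  exact F.M_mk_arrow _ hm

/-- Orthogonality in terms of generalized elements: membership in an `M`-subobject may be tested
after precomposing with a map of `E`. -/
theorem FactorizationSystem.factors_of_E {A B C : V} {e : A ⟶ B} (he : F.E e)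
    (S : Subobject C) (hS : F.M S.arrow) (g : B ⟶ C) (h : S.Factors (e ≫ g)) : S.Factors g := by
  obtain ⟨f, hf⟩ := (factors_iff_exists _ _).1 h
  obtain ⟨d, ⟨-, hd⟩, -⟩ := F.existsUnique_lift e S.arrow he hS f g hf
  exact (factors_iff_exists _ _).2 ⟨d, hd⟩

theorem FactorizationSystem.image_factors {A B C : V} (f : A ⟶ B) (g : B ⟶ C)
    (S : Subobject C) (hS : F.M S.arrow) (h : S.Factors (f ≫ g)) :
    S.Factors ((F.image f).arrow ≫ g) :=
  F.factors_of_E (F.E_toImage f) S hS _ (by rwa [← Category.assoc, F.toImage_arrow])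

/-- Converse of `factors_of_E`: as the arrow is monic, one triangle of the lifting problem implies
the other. It makes closure of `M` under pullback and intersection immediate. -/
theorem FactorizationSystem.M_arrow_of_factors (F : FactorizationSystem V) {C : V}
    (S : Subobject C) (H : ∀ {A B : V} (e : A ⟶ B), F.E e → ∀ g : B ⟶ C,
      S.Factors (e ≫ g) → S.Factors g) : F.M S.arrow := by
  refine F.M_of_lift _ fun {A B} e he f g hfg => ?_
  obtain ⟨d, hd⟩ := (factors_iff_exists _ _).1
    (H e he g ((factors_iff_exists _ _).2 ⟨f, hfg⟩))
  exact ⟨d, by rw [← cancel_mono S.arrow, Category.assoc, hd, hfg], hd⟩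

theorem FactorizationSystem.image_factors_self {A B W : V} (f : A ⟶ B) (g : W ⟶ A) :
    (F.image f).Factors (g ≫ f) :=
  (factors_iff_exists _ _).2 ⟨g ≫ F.toImage f, by rw [Category.assoc, F.toImage_arrow]⟩

/-- The colimit of a diagram of factorizations is a factorization of the colimit. -/
def FactorizationSystem.isColimitOfFactorization {J : Type w} [SmallCategory J]
    [F.M.IsStableUnderColimitsOfShape J] [HasColimits V] {G I H : J ⥤ V} (e : G ⟶ I) (m : I ⟶ H)
    (hm : ∀ j, F.M (m.app j)) {g : Cocone G} {i : Cocone I} {h : Cocone H} (hg : IsColimit g)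
    (hh : IsColimit h) (ec : g.pt ⟶ i.pt) (he : F.E ec) (mc : i.pt ⟶ h.pt) [Mono mc]
    (comm_e : ∀ j, g.ι.app j ≫ ec = e.app j ≫ i.ι.app j)
    (comm_m : ∀ j, i.ι.app j ≫ mc = m.app j ≫ h.ι.app j) : IsColimit i := by
  -- Closure of `M` under colimits makes the colimit of the `M`-parts again an `M`-subobject of
  -- `h.pt`.
  have hM : F.M (colimit.desc I ⟨h.pt, m ≫ h.ι⟩) :=
    MorphismProperty.IsStableUnderColimitsOfShape.condition (W := F.M) I H (colimit.cocone I) h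
      (colimit.isColimit I) hh m hm _ (by simp)
  have := F.mono_of_M _ hM
  -- Lifting `ec` against that `M`-map gives a map from `i.pt` to the colimit of `I`. It is inverse
  -- to the comparison because both objects are subobjects of `h.pt`.
  have hex := F.existsUnique_lift ec (colimit.desc I ⟨h.pt, m ≫ h.ι⟩) he hM
    (hg.desc ⟨_, e ≫ (colimit.cocone I).ι⟩) mc (hg.hom_ext fun j => by
      rw [IsColimit.fac_assoc, reassoc_of% (comm_e j), comm_m]
      simp)
  have h1 : hex.choose ≫ colimit.desc I ⟨h.pt, m ≫ h.ι⟩ = mc := hex.choose_spec.1.2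
  have h2 : colimit.desc I i ≫ mc = colimit.desc I ⟨h.pt, m ≫ h.ι⟩ :=
    colimit.hom_ext fun j => by simp [comm_m]
  have : IsIso ((colimit.isColimit I).desc i) := by
    refine ⟨hex.choose, ?_, ?_⟩
    · rw [← cancel_mono (colimit.desc I ⟨h.pt, m ≫ h.ι⟩), Category.assoc, h1]
      exact h2.trans (Category.id_comp _).symm
    · rw [← cancel_mono mc, Category.assoc]
      exact (congrArg _ h2).trans (h1.trans (Category.id_comp _).symm)
  exact IsColimit.ofPointIso (colimit.isColimit I)

end Image

/-! ### Naturality of currying and tupling -/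

section InternalHom

open MonoidalClosed

variable {V : Type u} [Category.{w} V] [MonoidalCategory V] [MonoidalClosed V]

theorem uncurry_uncurry_ihomTensorIso_hom {X Y A W : V} (k : W ⟶ (ihom (X ⊗ Y)).obj A) :
    uncurry (uncurry (k ≫ (ihomTensorIso X Y A).hom)) = (α_ X Y W).inv ≫ uncurry k := by
  rw [uncurry_natural_left, uncurry_natural_left, ihomTensorIso, uncurry_curry, uncurry_curry,
    associator_inv_naturality_right_assoc, ← uncurry_eq]

theorem ihomTensorIso_hom_naturality (X Y : V) {A B : V} (h : A ⟶ B) :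
    (ihom (X ⊗ Y)).map h ≫ (ihomTensorIso X Y B).hom =
      (ihomTensorIso X Y A).hom ≫ (ihom Y).map ((ihom X).map h) := by
  apply uncurry_injective
  apply uncurry_injective
  rw [uncurry_uncurry_ihomTensorIso_hom, uncurry_natural_right, uncurry_natural_right,
    ← Category.id_comp (ihomTensorIso X Y A).hom, uncurry_uncurry_ihomTensorIso_hom,
    uncurry_ihom_map, uncurry_id_eq_ev, Category.assoc]

theorem ihomTensorIso_inv_naturality (X Y : V) {A B : V} (h : A ⟶ B) :
    (ihomTensorIso X Y A).inv ≫ (ihom (X ⊗ Y)).map h =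
      (ihom Y).map ((ihom X).map h) ≫ (ihomTensorIso X Y B).inv := by
  rw [Iso.inv_comp_eq, ← Category.assoc, Iso.eq_comp_inv, ihomTensorIso_hom_naturality]

variable [SymmetricCategory V] [HasColimits V]

theorem ihomTuple_pre {W A : V} {J : Type w} (Y : J → V) (k : ∀ j, W ⟶ (ihom (Y j)).obj A)
    (j : J) : ihomTuple Y k ≫ (pre (Sigma.ι Y j)).app A = k j := by
  rw [ihomTuple, curry_pre_app, BraidedCategory.braiding_naturality_left_assoc,
    ← uncurry_natural_left, Sigma.ι_desc, uncurry_curry, SymmetricCategory.symmetry_assoc,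
    curry_uncurry]

/-- Transposing through the symmetry turns maps into `A ^ (∐ Y)` into maps out of `∐ Y`, where the
universal property of the coproduct applies. -/
theorem ihom_sigma_hom_ext {W A : V} {J : Type w} (Y : J → V) (f g : W ⟶ (ihom (∐ Y)).obj A)
    (h : ∀ j, f ≫ (pre (Sigma.ι Y j)).app A = g ≫ (pre (Sigma.ι Y j)).app A) : f = g := by
  apply uncurry_injective
  rw [← cancel_epi (β_ W (∐ Y)).hom]
  apply curry_injective
  refine Sigma.hom_ext _ _ fun j => ?_
  rw [← curry_natural_left, ← curry_natural_left,
    BraidedCategory.braiding_naturality_right_assoc,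
    BraidedCategory.braiding_naturality_right_assoc, ← uncurry_pre_app, ← uncurry_pre_app, h]

theorem ihomTuple_naturality {W A B : V} {J : Type w} (Y : J → V)
    (k : ∀ j, W ⟶ (ihom (Y j)).obj A) (h : A ⟶ B) :
    ihomTuple Y k ≫ (ihom (∐ Y)).map h = ihomTuple Y fun j => k j ≫ (ihom (Y j)).map h := by
  refine ihom_sigma_hom_ext _ _ _ fun j => ?_
  rw [ihomTuple_pre, Category.assoc, ← pre_comm_ihom_map, ← Category.assoc, ihomTuple_pre]

theorem comp_ihomTuple {W' W A : V} {J : Type w} (Y : J → V) (f : W' ⟶ W)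
    (k : ∀ j, W ⟶ (ihom (Y j)).obj A) :
    f ≫ ihomTuple Y k = ihomTuple Y fun j => f ≫ k j := by
  refine ihom_sigma_hom_ext _ _ _ fun j => ?_
  rw [ihomTuple_pre, Category.assoc, ihomTuple_pre]

end InternalHom

/-! ### Functoriality of interpretations; elementary morphisms -/

section Functoriality

variable {V : Type u} [Category.{w} V] [MonoidalCategory V] [SymmetricCategory V]
  [MonoidalClosed V] [HasColimits V] {F : FactorizationSystem V} {L : Language.{w} V}

/-- Interpretations of terms are natural in the structure. -/
theorem Str.map_term {A B : Str F L} (h : A ⟶ B) {X Y : V} (t : Term L X Y) :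
    (ihom X).map h.hom ≫ B.term t = A.term t ≫ (ihom Y).map h.hom := by
  induction t with
  | ofHom f => exact (MonoidalClosed.pre_comm_ihom_map f h.hom).symm
  | symb f => exact h.fn_comm f
  | @pow X Y t Z ih =>
    rw [Str.term, Str.term, ← Category.assoc, ihomTensorIso_hom_naturality, Category.assoc,
      ← Category.assoc ((ihom Z).map _), ← Functor.map_comp, ih, Functor.map_comp,
      Category.assoc, Category.assoc, Category.assoc, ihomTensorIso_inv_naturality]
  | tuple Y t ih =>
    rw [Str.term, Str.term, ihomTuple_naturality, comp_ihomTuple]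
    exact congrArg _ (funext ih)
  | comp t s iht ihs =>
    rw [Str.term, Str.term, ← Category.assoc, iht, Category.assoc, ihs, Category.assoc]

variable [HasLimits V]

theorem Str.M_interp_arrow (A : Str F L) {X : V} (φ : Formula L X) : F.M (A.interp φ).arrow := by
  induction φ with
  | eq s t => exact F.M_image_arrow _
  | rel R Y t =>
    have : Mono ((ihom Y).map (A.rel R).arrow) := inferInstance
    refine F.M_arrow_of_factors _ fun e he g h => ?_
    rw [Str.interp, pullback_factors_iff] at h ⊢
    rw [Category.assoc] at h
    exact F.factors_of_E he _ (F.M_mk_arrow _ (F.M_ihom _ (A.rel_mem R) Y)) _ h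
  | conj φ ih =>
    refine F.M_arrow_of_factors _ fun e he g h => ?_
    rw [Str.interp, inter_factors_iff] at h ⊢
    exact fun j => F.factors_of_E he _ (ih j) _ (h j)
  | ex Y ψ ih => exact F.M_image_arrow _
  | disj φ ih => exact F.M_image_arrow _

/-- Interpretations of formulas are functorial in the structure. -/
theorem Str.interp_factors_map {A B : Str F L} (h : A ⟶ B) {X : V} (φ : Formula L X) :
    (B.interp φ).Factors ((A.interp φ).arrow ≫ (ihom X).map h.hom) := by
  induction φ with
  | eq s t =>
    refine F.image_factors _ _ _ (B.M_interp_arrow _) ?_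
    have := F.image_factors_self (equalizer.ι (B.term s) (B.term t))
      (equalizer.lift (equalizer.ι (A.term s) (A.term t) ≫ (ihom _).map h.hom) (by
        rw [Category.assoc, Category.assoc, Str.map_term, Str.map_term,
          equalizer.condition_assoc]))
    rwa [equalizer.lift_ι] at this
  | @rel R Y Z t =>
    rw [Str.interp, Str.interp, pullback_factors_iff, Category.assoc,
      ← Category.assoc _ (B.term t), Str.map_term, Category.assoc, ihomTensorIso_hom_naturality]
    have : ((Subobject.pullback (A.term t ≫ (ihomTensorIso (L.ar R) Y A.carrier).hom)).obj
      (Subobject.mk ((ihom Y).map (A.rel R).arrow))).Factors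
        ((Subobject.pullback (A.term t ≫ (ihomTensorIso (L.ar R) Y A.carrier).hom)).obj
          (Subobject.mk ((ihom Y).map (A.rel R).arrow))).arrow := Subobject.factors_self _
    rw [pullback_factors_iff, mk_factors_iff_exists] at this
    obtain ⟨l, hl⟩ := this
    obtain ⟨k, hk⟩ := h.rel_comm R
    refine (mk_factors_iff_exists _ _).2 ⟨l ≫ (ihom Y).map k, ?_⟩
    rw [Category.assoc, ← Functor.map_comp, hk, Functor.map_comp, ← Category.assoc l, hl]
    simp only [Category.assoc]
  | conj φ ih =>
    rw [Str.interp, Str.interp, inter_factors_iff]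
    intro j
    obtain ⟨l, hl⟩ := (factors_iff_exists _ _).1 ((inter_factors_iff _ _).1
      (Subobject.factors_self (inter fun j => A.interp (φ j))) j)
    rw [← hl, Category.assoc]
    exact Subobject.factors_of_factors_right _ (ih j)
  | @ex X Y ψ ih =>
    refine F.image_factors _ _ _ (B.M_interp_arrow _) ?_
    obtain ⟨l, hl⟩ := (factors_iff_exists _ _).1 ih
    rw [Category.assoc, MonoidalClosed.pre_comm_ihom_map, ← Category.assoc, ← hl,
      Category.assoc]
    exact F.image_factors_self _ _
  | @disj X J φ ih =>
    refine F.image_factors _ _ _ (B.M_interp_arrow _) ?_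
    have hl := fun j => (B.interp (φ j)).factorThru_arrow _ (ih j)
    have : (Sigma.desc fun j => (A.interp (φ j)).arrow) ≫ (ihom X).map h.hom =
        (Limits.Sigma.map fun j => (B.interp (φ j)).factorThru _ (ih j)) ≫
          Sigma.desc fun j => (B.interp (φ j)).arrow :=
      Sigma.hom_ext _ _ fun j => by simp
    rw [this]
    exact F.image_factors_self _ _

/-- The morphism `φ_A ⟶ φ_B` induced by a morphism of structures. -/
def Str.interpMap {A B : Str F L} (h : A ⟶ B) {X : V} (φ : Formula L X) :
    (A.interp φ : V) ⟶ (B.interp φ : V) :=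
  (B.interp φ).factorThru _ (Str.interp_factors_map h φ)

theorem Str.interpMap_arrow {A B : Str F L} (h : A ⟶ B) {X : V} (φ : Formula L X) :
    Str.interpMap h φ ≫ (B.interp φ).arrow = (A.interp φ).arrow ≫ (ihom X).map h.hom :=
  Subobject.factorThru_arrow _ _ _

variable (F L) in
/-- The underlying object of a structure. -/
@[simps]
def forgetStr : Str F L ⥤ V where
  obj A := A.carrier
  map h := h.hom
  map_id _ := rfl
  map_comp _ _ := rfl

variable (F) in
/-- The interpretation of a formula, as a functor of the structure. -/
@[simps]
def interpFunctor {X : V} (φ : Formula L X) : Str F L ⥤ V where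
  obj A := A.interp φ
  map h := Str.interpMap h φ
  map_id A := by
    rw [← cancel_mono (A.interp φ).arrow, Str.interpMap_arrow]
    exact (congrArg _ ((ihom X).map_id _)).trans (by simp)
  map_comp {A B C} h k := by
    rw [← cancel_mono (C.interp φ).arrow, Str.interpMap_arrow, Category.assoc,
      Str.interpMap_arrow, ← Category.assoc, Str.interpMap_arrow, Category.assoc]
    exact congrArg _ ((ihom X).map_comp _ _)

variable (F) in
/-- The inclusion of `φ_A` in `A ^ X`. -/
@[simps]
def interpι {X : V} (φ : Formula L X) : interpFunctor F φ ⟶ forgetStr F L ⋙ ihom X where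
  app A := (A.interp φ).arrow
  naturality _ _ h := Str.interpMap_arrow h φ

/-- Models descend along morphisms which are elementary for the right-hand sides of the sequents. -/
theorem Mod.of_isElementaryFor {T : Set (Sequent L)} {K N : Str F L} (f : K ⟶ N)
    (hf : ∀ σ ∈ T, IsElementaryFor f σ.rhs) (hN : Mod F T N) : Mod F T K := by
  intro σ hσ
  obtain ⟨g, hg⟩ := hf σ hσ
  have h := Str.interp_factors_map f σ.lhs
  obtain ⟨l, hl⟩ := (factors_iff_exists _ _).1 (Subobject.factors_of_le _ (hN σ hσ) h)
  exact Subobject.le_of_factors ((factors_iff_exists _ _).2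
    ⟨hg.lift l (K.interp σ.lhs).arrow hl, hg.lift_snd _ _ _⟩)

/-- An isomorphism is elementary for every formula, since a commutative square with two opposite
sides invertible is a pullback. -/
theorem Mod.of_iso {T : Set (Sequent L)} {K N : Str F L} (e : K ≅ N) (hN : Mod F T N) :
    Mod F T K := by
  refine Mod.of_isElementaryFor e.hom (fun σ _ => ⟨Str.interpMap e.hom σ.rhs, ?_⟩) hN
  have : IsIso ((ihom σ.arity).map e.hom.hom) :=
    inferInstanceAs (IsIso ((forgetStr F L ⋙ ihom σ.arity).map e.hom))
  have : IsIso (Str.interpMap e.hom σ.rhs) :=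
    inferInstanceAs (IsIso ((interpFunctor F σ.rhs).map e.hom))
  exact IsPullback.of_horiz_isIso ⟨Str.interpMap_arrow _ _⟩

end Functoriality

/-! ### Powers of subobjects, images, equalizers and coproducts -/

section Powers

open MonoidalClosed

variable {V : Type u} [Category.{w} V] [MonoidalCategory V] [MonoidalClosed V]

/-- If `B` is `C ^ X`, the power `S ^ X` of a subobject `S` of `C`, as a subobject of `B`. -/
def powSubobject {X B C : V} (e : B ≅ (ihom X).obj C) (S : Subobject C) : Subobject B :=
  Subobject.mk ((ihom X).map S.arrow ≫ e.inv)

/-- This is the tensor-hom adjunction. It reduces claims about powers of subobjects to claims about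
the subobjects themselves. -/
theorem mk_ihom_map_factors_iff {X B W : V} (S : Subobject B) (k : W ⟶ (ihom X).obj B) :
    (Subobject.mk ((ihom X).map S.arrow)).Factors k ↔ S.Factors (uncurry k) := by
  rw [mk_factors_iff_exists, factors_iff_exists]
  constructor
  · rintro ⟨l, rfl⟩
    exact ⟨uncurry l, (uncurry_natural_right _ _).symm⟩
  · rintro ⟨l, hl⟩
    exact ⟨curry l, by rw [← curry_natural_right, hl, curry_uncurry]⟩

theorem powSubobject_factors_iff {X B C W : V} (e : B ≅ (ihom X).obj C) (S : Subobject C)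
    (k : W ⟶ B) : (powSubobject e S).Factors k ↔ S.Factors (uncurry (k ≫ e.hom)) := by
  rw [← mk_ihom_map_factors_iff, mk_factors_iff_exists, powSubobject, mk_factors_iff_exists]
  refine exists_congr fun l => ?_
  rw [← Category.assoc, Iso.comp_inv_eq]

theorem powSubobject_mono {X B C : V} (e : B ≅ (ihom X).obj C) {S T : Subobject C} (h : S ≤ T) :
    powSubobject e S ≤ powSubobject e T :=
  Subobject.le_of_factors ((powSubobject_factors_iff _ _ _).2
    (Subobject.factors_of_le _ h ((powSubobject_factors_iff _ _ _).1 (Subobject.factors_self _))))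

theorem exists_powSubobject_iso {X B C : V} (e : B ≅ (ihom X).obj C) (S : Subobject C) :
    ∃ i : (powSubobject e S : V) ≅ (ihom X).obj (S : V),
      (powSubobject e S).arrow ≫ e.hom = i.hom ≫ (ihom X).map S.arrow :=
  ⟨Subobject.underlyingIso _, by
    rw [← Iso.eq_comp_inv, Category.assoc]
    exact (Subobject.underlyingIso_hom_comp_eq_mk _).symm⟩

/-- Powering the factorization of `f` gives a factorization of `f'`: stability of `X` keeps the left
part in `E`, and the right part stays in `M` because `E` is closed under tensoring. -/
theorem FactorizationSystem.image_eq_powSubobject {F : FactorizationSystem V} {X : V}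
    (hX : F.IsStable X) {B C D D' : V} (e : B ≅ (ihom X).obj C) (f : D ⟶ C) (f' : D' ⟶ B)
    (i : D' ⟶ (ihom X).obj D) (hi : IsIso i) (h : f' ≫ e.hom = i ≫ (ihom X).map f) :
    F.image f' = powSubobject e (F.image f) := by
  have h' : f' = (i ≫ (ihom X).map (F.toImage f)) ≫ ((ihom X).map (F.image f).arrow ≫ e.inv) := by
    rw [Category.assoc, ← Functor.map_comp_assoc, F.toImage_arrow, ← Category.assoc, ← h,
      Category.assoc, Iso.hom_inv_id, Category.comp_id]
  rw [h']
  exact F.image_eq_mk _ _ (F.E_comp _ _ (F.E_of_isIso _ inferInstance) (hX _ (F.E_toImage f)))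
    (F.M_comp _ _ (F.M_ihom _ (F.M_image_arrow f) X) (F.M_of_isIso _ inferInstance))

/-- Powers of equalizers are equalizers. -/
theorem exists_equalizer_iso_of_powIso {X B C B' C' : V} (e : B' ≅ (ihom X).obj B)
    (e' : C' ≅ (ihom X).obj C) (s t : B ⟶ C) (s' t' : B' ⟶ C')
    [HasEqualizer s t] [HasEqualizer s' t']
    (hs : s' ≫ e'.hom = e.hom ≫ (ihom X).map s) (ht : t' ≫ e'.hom = e.hom ≫ (ihom X).map t) :
    ∃ i : equalizer s' t' ≅ (ihom X).obj (equalizer s t),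
      equalizer.ι s' t' ≫ e.hom = i.hom ≫ (ihom X).map (equalizer.ι s t) := by
  let a : equalizer s' t' ⟶ (ihom X).obj (equalizer s t) :=
    curry (equalizer.lift (uncurry (equalizer.ι s' t' ≫ e.hom)) (by
      rw [← uncurry_natural_right, ← uncurry_natural_right, Category.assoc, Category.assoc,
        ← hs, ← ht, equalizer.condition_assoc]))
  have ha : a ≫ (ihom X).map (equalizer.ι s t) = equalizer.ι s' t' ≫ e.hom := by
    rw [← curry_natural_right, equalizer.lift_ι, curry_uncurry]
  let b : (ihom X).obj (equalizer s t) ⟶ equalizer s' t' :=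
    equalizer.lift ((ihom X).map (equalizer.ι s t) ≫ e.inv) (by
      rw [← cancel_mono e'.hom]
      simp only [Category.assoc, hs, ht, Iso.inv_hom_id_assoc]
      rw [← Functor.map_comp, equalizer.condition, Functor.map_comp])
  have hb : b ≫ equalizer.ι s' t' = (ihom X).map (equalizer.ι s t) ≫ e.inv :=
    equalizer.lift_ι _ _
  refine ⟨⟨a, b, ?_, ?_⟩, ha.symm⟩
  · rw [← cancel_mono (equalizer.ι s' t'), Category.assoc, hb, reassoc_of% ha]
    simp
  · rw [← cancel_mono ((ihom X).map (equalizer.ι s t)), Category.assoc, ha, reassoc_of% hb]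
    simp

variable [HasColimits V]

/-- Connectedness of `X` enters here, through the invertible comparison from the coproduct of powers
to the power of the coproduct. It serves the disjunction case. -/
theorem exists_sigma_iso_of_ihom {X : V} (hX : IsVConnected X) {B C : V}
    (e : B ≅ (ihom X).obj C) {J : Type w} (D D' : J → V) (f : ∀ j, D j ⟶ C) (f' : ∀ j, D' j ⟶ B)
    (i : ∀ j, D' j ≅ (ihom X).obj (D j)) (h : ∀ j, f' j ≫ e.hom = (i j).hom ≫ (ihom X).map (f j)) :
    ∃ i : ∐ D' ≅ (ihom X).obj (∐ D),
      Sigma.desc f' ≫ e.hom = i.hom ≫ (ihom X).map (Sigma.desc f) := by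
  have := hX J
  refine ⟨Limits.Sigma.mapIso i ≪≫ (PreservesCoproduct.iso (ihom X) D).symm, ?_⟩
  refine Sigma.hom_ext _ _ fun j => ?_
  simp [h]

end Powers

/-! ### Coherence of the exchange of exponents -/

section Swap

open MonoidalClosed

variable {V : Type u} [Category.{w} V] [MonoidalCategory V] [SymmetricCategory V]

theorem leftSwap_naturality_left {Y Y' : V} (f : Y' ⟶ Y) (X W : V) :
    f ▷ (X ⊗ W) ≫ leftSwap Y X W = leftSwap Y' X W ≫ X ◁ f ▷ W := by
  have h := congrArg (· ▷ W) (BraidedCategory.braiding_naturality_left f X)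
  simp only [comp_whiskerRight] at h
  rw [leftSwap, leftSwap, associator_inv_naturality_left_assoc, reassoc_of% h]
  simp

theorem leftSwap_naturality_middle {X X' : V} (Y : V) (f : X' ⟶ X) (W : V) :
    Y ◁ f ▷ W ≫ leftSwap Y X W = leftSwap Y X' W ≫ f ▷ (Y ⊗ W) := by
  have h := congrArg (· ▷ W) (BraidedCategory.braiding_naturality_right Y f)
  simp only [comp_whiskerRight] at h
  rw [leftSwap, leftSwap, associator_inv_naturality_middle_assoc, reassoc_of% h]
  simp

theorem leftSwap_tensor_left (Y Z X W : V) :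
    (α_ Y Z (X ⊗ W)).inv ≫ leftSwap (Y ⊗ Z) X W =
      Y ◁ leftSwap Z X W ≫ leftSwap Y X (Z ⊗ W) ≫ X ◁ (α_ Y Z W).inv := by
  simp [leftSwap]

theorem leftSwap_unit (Y W : V) :
    leftSwap Y (𝟙_ V) W ≫ (λ_ (Y ⊗ W)).hom = Y ◁ (λ_ W).hom := by
  simp [leftSwap]

variable [MonoidalClosed V]

/-- After two transpositions, exchanging exponents is precomposition with `leftSwap`. The identities
about `ihomSwap` below thus become coherence statements for the symmetry. -/
theorem uncurry_uncurry_comp_ihomSwap {X Y A W : V} (k : W ⟶ (ihom Y).obj ((ihom X).obj A)) :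
    uncurry (uncurry (k ≫ ihomSwap X Y A)) = leftSwap Y X W ≫ uncurry (uncurry k) := by
  rw [uncurry_natural_left, uncurry_natural_left, uncurry_uncurry_ihomSwap,
    leftSwap_natural_assoc, uncurry_eq (uncurry k), uncurry_eq k, whiskerLeft_comp,
    Category.assoc]

theorem pre_ihomSwap {Y Y' : V} (f : Y' ⟶ Y) (X A : V) :
    (pre f).app ((ihom X).obj A) ≫ ihomSwap X Y' A =
      ihomSwap X Y A ≫ (ihom X).map ((pre f).app A) := by
  apply uncurry_injective
  apply uncurry_injective
  rw [uncurry_uncurry_comp_ihomSwap, uncurry_natural_right, uncurry_pre_app,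
    uncurry_uncurry_ihomSwap, ← Category.assoc, leftSwap_naturality_left, uncurry_pre,
    uncurry_eq, whiskerLeft_comp]
  simp only [Category.assoc]

theorem ihomTensorIso_ihomSwap (X Y Z A : V) :
    (ihomTensorIso Y Z ((ihom X).obj A)).hom ≫ (ihom Z).map (ihomSwap X Y A) ≫
        ihomSwap X Z ((ihom Y).obj A) =
      ihomSwap X (Y ⊗ Z) A ≫ (ihom X).map (ihomTensorIso Y Z A).hom := by
  apply uncurry_injective
  apply uncurry_injective
  apply uncurry_injective
  rw [← Category.assoc, uncurry_uncurry_comp_ihomSwap, uncurry_natural_right,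
    uncurry_natural_right, uncurry_uncurry_ihomTensorIso_hom, uncurry_natural_left,
    uncurry_uncurry_comp_ihomSwap, ← Category.id_comp (ihomTensorIso Y Z _).hom,
    uncurry_uncurry_ihomTensorIso_hom, uncurry_natural_left,
    ← Category.id_comp (ihomSwap X (Y ⊗ Z) A), uncurry_uncurry_comp_ihomSwap,
    ← Category.assoc (α_ _ _ _).inv, leftSwap_tensor_left]
  simp only [Category.assoc]

/-- If `B` is `A ^ X`, then `B ^ Y` is `(A ^ Y) ^ X`. -/
@[simps!]
def powIso {X A B : V} (e : B ≅ (ihom X).obj A) (Y : V) :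
    (ihom Y).obj B ≅ (ihom X).obj ((ihom Y).obj A) :=
  (ihom Y).mapIso e ≪≫ ihomSwapIso X Y A

theorem pre_powIso {X A B : V} (e : B ≅ (ihom X).obj A) {Y Y' : V} (f : Y' ⟶ Y) :
    (pre f).app B ≫ (powIso e Y').hom = (powIso e Y).hom ≫ (ihom X).map ((pre f).app A) := by
  rw [powIso_hom, powIso_hom, Category.assoc, ← pre_ihomSwap, ← Category.assoc,
    pre_comm_ihom_map, Category.assoc]

theorem powIso_naturality {X A B A' B' : V} (e : B ≅ (ihom X).obj A) (e' : B' ≅ (ihom X).obj A')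
    (Y : V) (b : B ⟶ B') (a : A ⟶ A') (h : b ≫ e'.hom = e.hom ≫ (ihom X).map a) :
    (ihom Y).map b ≫ (powIso e' Y).hom = (powIso e Y).hom ≫ (ihom X).map ((ihom Y).map a) := by
  have hs : (ihom Y).map ((ihom X).map a) ≫ ihomSwap X Y A' =
      ihomSwap X Y A ≫ (ihom X).map ((ihom Y).map a) := by
    apply uncurry_injective
    apply uncurry_injective
    rw [uncurry_uncurry_comp_ihomSwap, uncurry_natural_right, uncurry_natural_right,
      uncurry_uncurry_ihomSwap, uncurry_ihom_map, uncurry_natural_left, uncurry_ihom_map]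
    simp only [Category.assoc]
  rw [powIso_hom, powIso_hom, ← Functor.map_comp_assoc, h, Functor.map_comp, Category.assoc, hs,
    Category.assoc]

theorem ihomTensorIso_powIso {X A B : V} (e : B ≅ (ihom X).obj A) (Y Z : V) :
    (ihomTensorIso Y Z B).hom ≫ (powIso (powIso e Y) Z).hom =
      (powIso e (Y ⊗ Z)).hom ≫ (ihom X).map (ihomTensorIso Y Z A).hom := by
  rw [powIso_hom, powIso_hom, powIso_hom, Functor.map_comp, Category.assoc, Category.assoc,
    ← ihomTensorIso_ihomSwap, ← Category.assoc, ← ihomTensorIso_hom_naturality, Category.assoc]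

theorem uncurry_uncurry_comp_powIso {X A B W : V} (e : B ≅ (ihom X).obj A) {Y : V}
    (k : W ⟶ (ihom Y).obj B) :
    uncurry (uncurry (k ≫ (powIso e Y).hom)) = leftSwap Y X W ≫ uncurry (uncurry k ≫ e.hom) := by
  rw [powIso_hom, ← Category.assoc, uncurry_uncurry_comp_ihomSwap, uncurry_natural_right]

theorem powMap_whiskerRight {Z Z' A B : V} (Y : V) (f : Z' ⟶ Z) (h : Z ⊗ A ⟶ B) :
    powMap Y (f ▷ A ≫ h) = f ▷ (ihom Y).obj A ≫ powMap Y h := by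
  apply uncurry_injective
  rw [uncurry_powMap, uncurry_natural_left, uncurry_powMap, ← Category.assoc (Y ◁ _),
    leftSwap_naturality_middle, Category.assoc, ← whisker_exchange_assoc]
  rfl

theorem powMap_unit {A B : V} (Y : V) (f : A ⟶ B) :
    powMap Y ((λ_ A).hom ≫ f) = (λ_ _).hom ≫ (ihom Y).map f := by
  apply uncurry_injective
  rw [uncurry_powMap, uncurry_natural_left, uncurry_ihom_map, ← leftSwap_unit,
    Category.assoc, ← leftUnitor_naturality_assoc]
  rfl

end Swap

/-! ### Universal property of powers, and interpretation in a power -/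

section PowerTransport

open MonoidalClosed

variable {V : Type u} [Category.{w} V] [MonoidalCategory V] [SymmetricCategory V]
  [MonoidalClosed V] {F : FactorizationSystem V} {L : Language.{w} V}

theorem IsFamilyOfHoms.whiskerRight {A B : Str F L} {Z Z' : V} (f : Z' ⟶ Z)
    {h : Z ⊗ A.carrier ⟶ B.carrier} (hh : IsFamilyOfHoms Z h) :
    IsFamilyOfHoms (A := A) (B := B) Z' (f ▷ A.carrier ≫ h) where
  fn_comm s := by
    rw [powMap_whiskerRight, powMap_whiskerRight, Category.assoc, hh.fn_comm,
      whisker_exchange_assoc]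
  rel_comm R := by
    obtain ⟨k, hk⟩ := hh.rel_comm R
    exact ⟨f ▷ _ ≫ k, by rw [powMap_whiskerRight, Category.assoc, hk, whisker_exchange_assoc]⟩

theorem Str.Hom.isFamilyOfHoms {A B : Str F L} (f : A ⟶ B) :
    IsFamilyOfHoms (A := A) (B := B) (𝟙_ V) ((λ_ A.carrier).hom ≫ f.hom) where
  fn_comm s := by
    rw [powMap_unit, powMap_unit, Category.assoc, f.fn_comm, leftUnitor_naturality_assoc]
  rel_comm R := by
    obtain ⟨k, hk⟩ := f.rel_comm R
    exact ⟨(λ_ _).hom ≫ k, by rw [powMap_unit, Category.assoc, hk, leftUnitor_naturality_assoc]⟩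

/-- A family of morphisms parametrized by the unit is a morphism. -/
def IsFamilyOfHoms.toHom {A B : Str F L} {f : A.carrier ⟶ B.carrier}
    (h : IsFamilyOfHoms (A := A) (B := B) (𝟙_ V) ((λ_ A.carrier).hom ≫ f)) : A ⟶ B where
  hom := f
  fn_comm s := by
    have := h.fn_comm s
    rwa [powMap_unit, powMap_unit, Category.assoc, leftUnitor_naturality_assoc,
      cancel_epi] at this
  rel_comm R := by
    obtain ⟨k, hk⟩ := h.rel_comm R
    refine ⟨(λ_ _).inv ≫ k, ?_⟩
    rw [Category.assoc, hk, powMap_unit, leftUnitor_naturality_assoc, Iso.inv_hom_id_assoc]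

/-- The enriched universal property at the unit object, with the unitors removed; this ordinary form
gives uniqueness of powers. -/
theorem IsPower.existsUnique_hom {X : V} {A P : Str F L} {ε : X ⊗ P.carrier ⟶ A.carrier}
    (hP : IsPower X A P ε) {C : Str F L} {g : X ⊗ C.carrier ⟶ A.carrier}
    (hg : IsFamilyOfHoms X g) : ∃! h : C ⟶ P, X ◁ h.hom ≫ ε = g := by
  have key : ∀ k : C.carrier ⟶ P.carrier, (α_ X (𝟙_ V) C.carrier).hom ≫
      X ◁ ((λ_ C.carrier).hom ≫ k) ≫ ε = (ρ_ X).hom ▷ C.carrier ≫ g ↔ X ◁ k ≫ ε = g := by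
    intro k
    rw [whiskerLeft_comp, Category.assoc, triangle_assoc, cancel_epi]
  obtain ⟨h, ⟨h1, h2⟩, h3⟩ := hP.existsUnique C (𝟙_ V) _ (hg.whiskerRight (ρ_ X).hom)
  have e : h = (λ_ C.carrier).hom ≫ (λ_ C.carrier).inv ≫ h := by simp
  rw [e] at h1 h2
  refine ⟨h1.toHom, (key _).1 h2, fun k hk => ?_⟩
  have := h3 _ ⟨k.isFamilyOfHoms, (key _).2 hk⟩
  apply Str.Hom.ext
  change k.hom = (λ_ C.carrier).inv ≫ h
  rw [← this, Iso.inv_hom_id_assoc]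

/-- Powers are unique up to isomorphism. -/
theorem IsPower.nonempty_iso {X : V} {A P Q : Str F L} {ε : X ⊗ P.carrier ⟶ A.carrier}
    {δ : X ⊗ Q.carrier ⟶ A.carrier} (hP : IsPower X A P ε) (hQ : IsPower X A Q δ) :
    Nonempty (P ≅ Q) := by
  obtain ⟨f, hf, -⟩ := hQ.existsUnique_hom hP.counit
  obtain ⟨g, hg, -⟩ := hP.existsUnique_hom hQ.counit
  refine ⟨⟨f, g, (hP.existsUnique_hom hP.counit).unique ?_ ?_,
    (hQ.existsUnique_hom hQ.counit).unique ?_ ?_⟩⟩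
  · change X ◁ (f.hom ≫ g.hom) ≫ ε = ε
    rw [whiskerLeft_comp, Category.assoc, hg, hf]
  · change X ◁ (𝟙 _) ≫ ε = ε
    simp
  · change X ◁ (g.hom ≫ f.hom) ≫ δ = δ
    rw [whiskerLeft_comp, Category.assoc, hf, hg]
  · change X ◁ (𝟙 _) ≫ δ = δ
    simp

/-- `P` is the power of `A` by `X`, computed in `V` along the isomorphism `e`. -/
structure Str.IsPowerAlong {X : V} {A P : Str F L} (e : P.carrier ≅ (ihom X).obj A.carrier) :
    Prop where
  fn f : P.fn f ≫ (powIso e (L.cod f)).hom = (powIso e (L.dom f)).hom ≫ (ihom X).map (A.fn f)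
  rel R : P.rel R = powSubobject (powIso e (L.ar R)) (A.rel R)

theorem Str.isPowerAlong_power (A : Str F L) (X : V) :
    Str.IsPowerAlong (A := A) (P := A.power X) (Iso.refl ((ihom X).obj A.carrier)) := by
  have h (Y : V) : powIso (Iso.refl ((ihom X).obj A.carrier)) Y = ihomSwapIso X Y A.carrier := by
    ext
    simp
  have h1 (D D' : V) (a : (ihom D).obj A.carrier ⟶ (ihom D').obj A.carrier) :
      (ihomSwap X D A.carrier ≫ (ihom X).map a ≫ ihomSwap D' X A.carrier) ≫
          (powIso (Iso.refl ((ihom X).obj A.carrier)) D').hom =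
        (powIso (Iso.refl ((ihom X).obj A.carrier)) D).hom ≫ (ihom X).map a := by
    rw [h, h]
    simp [ihomSwap_ihomSwap]
  refine ⟨fun f => h1 _ _ _, fun R => ?_⟩
  exact congrArg (powSubobject · (A.rel R)) (h (L.ar R)).symm

variable [HasColimits V]

theorem Str.IsPowerAlong.term {X : V} {A P : Str F L} {e : P.carrier ≅ (ihom X).obj A.carrier}
    (he : Str.IsPowerAlong e) {Y Z : V} (t : Term L Y Z) :
    P.term t ≫ (powIso e Z).hom = (powIso e Y).hom ≫ (ihom X).map (A.term t) := by
  induction t with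
  | ofHom f => exact pre_powIso e f
  | symb f => exact he.fn f
  | @pow Y Z t W ih =>
    have h : (ihomTensorIso Z W P.carrier).inv ≫ (powIso e (Z ⊗ W)).hom =
        (powIso (powIso e Z) W).hom ≫ (ihom X).map (ihomTensorIso Z W A.carrier).inv := by
      rw [Iso.inv_comp_eq, ← Category.assoc, ihomTensorIso_powIso, Category.assoc,
        ← Functor.map_comp, Iso.hom_inv_id, CategoryTheory.Functor.map_id, Category.comp_id]
    rw [Str.term, Str.term, Category.assoc, Category.assoc, h, ← Category.assoc ((ihom W).map _),
      powIso_naturality _ _ W _ _ ih, Functor.map_comp, Functor.map_comp, ← Category.assoc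
      (powIso e (Y ⊗ W)).hom, ← ihomTensorIso_powIso]
    simp only [Category.assoc]
  | tuple Y t ih =>
    -- Transposing removes the outer exponent `X`, leaving an equality of maps into `A ^ (∐ Y)` that
    -- can be checked componentwise.
    apply uncurry_injective
    refine ihom_sigma_hom_ext _ _ _ fun j => ?_
    rw [← uncurry_natural_right, ← uncurry_natural_right, Category.assoc, ← pre_powIso,
      Category.assoc, ← Functor.map_comp, Str.term, Str.term, ihomTuple_pre, ← ih,
      ← Category.assoc, ihomTuple_pre]
  | comp t s iht ihs =>
    rw [Str.term, Str.term, Category.assoc, ihs, ← Category.assoc, iht, Category.assoc,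
      Functor.map_comp]

variable [HasLimits V]

/-- Induction on the formula. Relations and conjunctions are compared on generalized elements by
adjunction; equalities, existentials and disjunctions are images of a map whose power is known, so
`image_eq_powSubobject` applies. -/
theorem Str.IsPowerAlong.interp {X : V} (hX : F.IsStable X) (hX' : IsVConnected X)
    {A P : Str F L} {e : P.carrier ≅ (ihom X).obj A.carrier} (he : Str.IsPowerAlong e)
    {Y : V} (φ : Formula L Y) : P.interp φ = powSubobject (powIso e Y) (A.interp φ) := by
  induction φ with
  | @eq Y Z s t =>
    obtain ⟨i, hi⟩ := exists_equalizer_iso_of_powIso (powIso e Y) (powIso e Z) (A.term s)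
      (A.term t) (P.term s) (P.term t) (he.term s) (he.term t)
    exact F.image_eq_powSubobject hX _ _ _ i.hom inferInstance hi
  | @rel R Y Z t =>
    refine eq_of_factors_iff fun W k => ?_
    rw [powSubobject_factors_iff, Str.interp, Str.interp, pullback_factors_iff,
      pullback_factors_iff, mk_ihom_map_factors_iff, mk_ihom_map_factors_iff, he.rel,
      powSubobject_factors_iff]
    have h : uncurry (k ≫ (powIso e Z).hom) ≫ A.term t ≫ (ihomTensorIso (L.ar R) Y _).hom =
        uncurry ((k ≫ P.term t ≫ (ihomTensorIso (L.ar R) Y _).hom) ≫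
          (powIso (powIso e (L.ar R)) Y).hom) := by
      rw [← uncurry_natural_right, Category.assoc, Functor.map_comp,
        ← Category.assoc (powIso e Z).hom, ← he.term]
      simp only [Category.assoc, ihomTensorIso_powIso]
    -- The powers by `X` and by `Y` are taken in opposite orders on the two sides, so the conditions
    -- differ by the invertible map `leftSwap`.
    rw [h, uncurry_uncurry_comp_powIso]
    refine ⟨fun h => Subobject.factors_of_factors_right _ h, fun h => ?_⟩
    have := Subobject.factors_of_factors_right (leftSwap X Y W) h
    rwa [leftSwap_leftSwap_assoc] at this
  | conj φ ih =>
    refine eq_of_factors_iff fun W k => ?_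
    rw [powSubobject_factors_iff, Str.interp, Str.interp, inter_factors_iff, inter_factors_iff]
    exact forall_congr' fun j => by rw [ih, powSubobject_factors_iff]
  | @ex Y Z ψ ih =>
    rw [Str.interp, Str.interp, ih]
    obtain ⟨i, hi⟩ := exists_powSubobject_iso (powIso e (Y ⨿ Z)) (A.interp ψ)
    refine F.image_eq_powSubobject hX _ _ _ i.hom inferInstance ?_
    rw [Category.assoc, pre_powIso, ← Category.assoc, hi, Category.assoc, Functor.map_comp]
  | @disj Y J φ ih =>
    have h (j : J) : ∃ i : (P.interp (φ j) : V) ≅ (ihom X).obj (A.interp (φ j) : V),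
        (P.interp (φ j)).arrow ≫ (powIso e Y).hom =
          i.hom ≫ (ihom X).map (A.interp (φ j)).arrow := by
      rw [ih]
      exact exists_powSubobject_iso (powIso e Y) (A.interp (φ j))
    choose i hi using h
    obtain ⟨a, ha⟩ := exists_sigma_iso_of_ihom hX' (powIso e Y)
      (fun j => (A.interp (φ j) : V)) (fun j => (P.interp (φ j) : V))
      (fun j => (A.interp (φ j)).arrow) (fun j => (P.interp (φ j)).arrow) i hi
    exact F.image_eq_powSubobject hX _ _ _ a.hom inferInstance ha

/-- Models are stable under powers by `E`-stable `V`-connected objects. -/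
theorem Mod.of_isPower {T : Set (Sequent L)} {X : V} (hX : F.IsStable X) (hX' : IsVConnected X)
    {A P : Str F L} {ε : X ⊗ P.carrier ⟶ A.carrier} (hP : IsPower X A P ε) (hA : Mod F T A) :
    Mod F T P := by
  obtain ⟨i⟩ := hP.nonempty_iso (isPower_power A X)
  refine Mod.of_iso i fun σ hσ => ?_
  rw [(A.isPowerAlong_power X).interp hX hX', (A.isPowerAlong_power X).interp hX hX']
  exact powSubobject_mono _ (hA σ hσ)

end PowerTransport

/-! ### Directed colimits of structures -/

section RelFunctor

variable {V : Type u} [Category.{w} V] [MonoidalCategory V] [MonoidalClosed V]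
  {F : FactorizationSystem V} {L : Language.{w} V}

theorem Str.rel_factors_map {A B : Str F L} (h : A ⟶ B) (R : L.Rel) :
    (B.rel R).Factors ((A.rel R).arrow ≫ (ihom (L.ar R)).map h.hom) :=
  (factors_iff_exists _ _).2 (h.rel_comm R)

/-- The morphism `R_A ⟶ R_B` induced by a morphism of structures. -/
def Str.relMap {A B : Str F L} (h : A ⟶ B) (R : L.Rel) : (A.rel R : V) ⟶ (B.rel R : V) :=
  (B.rel R).factorThru _ (Str.rel_factors_map h R)

theorem Str.relMap_arrow {A B : Str F L} (h : A ⟶ B) (R : L.Rel) :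
    Str.relMap h R ≫ (B.rel R).arrow = (A.rel R).arrow ≫ (ihom (L.ar R)).map h.hom :=
  Subobject.factorThru_arrow _ _ _

variable (F) in
/-- The interpretation of a relation symbol, as a functor of the structure. -/
@[simps]
def relFunctor (R : L.Rel) : Str F L ⥤ V where
  obj A := A.rel R
  map h := Str.relMap h R
  map_id A := by
    rw [← cancel_mono (A.rel R).arrow, Str.relMap_arrow]
    exact (congrArg _ ((ihom _).map_id _)).trans (by simp)
  map_comp {A B C} h k := by
    rw [← cancel_mono (C.rel R).arrow, Str.relMap_arrow, Category.assoc,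
      Str.relMap_arrow, ← Category.assoc, Str.relMap_arrow, Category.assoc]
    exact congrArg _ ((ihom _).map_comp _ _)

variable {J : Type w} [SmallCategory J] {D : J ⥤ Str F L}

/-- A cocone of structures is colimit if it is on underlying objects, on powers by the input
arities, and on relations. -/
theorem nonempty_isColimit_of_forgetStr_relFunctor (c : Cocone D)
    (hc : IsColimit ((forgetStr F L).mapCocone c))
    (hdom : ∀ f : L.Fun, IsColimit ((ihom (L.dom f)).mapCocone ((forgetStr F L).mapCocone c)))
    (hrel : ∀ R : L.Rel, IsColimit ((relFunctor F R).mapCocone c)) : Nonempty (IsColimit c) := by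
  let i (j : J) : D.obj j ⟶ c.pt := c.ι.app j
  have key (s : Cocone D) : ∃ d : c.pt ⟶ s.pt, d.hom = hc.desc ((forgetStr F L).mapCocone s) := by
    let t (j : J) : D.obj j ⟶ s.pt := s.ι.app j
    obtain ⟨d, hd⟩ : ∃ d : c.pt.carrier ⟶ s.pt.carrier,
      d = hc.desc ((forgetStr F L).mapCocone s) := ⟨_, rfl⟩
    have h (j) : (i j).hom ≫ d = (t j).hom := by
      rw [hd]
      exact hc.fac _ j
    have h' (Y : V) (j) : (ihom Y).map (i j).hom ≫ (ihom Y).map d = (ihom Y).map (t j).hom := by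
      rw [← Functor.map_comp, h]
    refine ⟨⟨d, fun f => (hdom f).hom_ext fun j => ?_, fun R => ?_⟩, hd⟩
    · have : (ihom (L.dom f)).map (i j).hom ≫ (ihom (L.dom f)).map d ≫ s.pt.fn f =
          (ihom (L.dom f)).map (i j).hom ≫ c.pt.fn f ≫ (ihom (L.cod f)).map d := by
        rw [reassoc_of% (h' (L.dom f) j), ← Category.assoc, (i j).fn_comm, Category.assoc, h',
          (t j).fn_comm]
      exact this
    · obtain ⟨k, hk⟩ : ∃ k : (c.pt.rel R : V) ⟶ (s.pt.rel R : V),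
        ∀ j, Str.relMap (i j) R ≫ k = Str.relMap (t j) R :=
        ⟨(hrel R).desc ((relFunctor F R).mapCocone s), fun j => (hrel R).fac _ j⟩
      refine ⟨k, (hrel R).hom_ext fun j => ?_⟩
      have : Str.relMap (i j) R ≫ k ≫ (s.pt.rel R).arrow =
          Str.relMap (i j) R ≫ (c.pt.rel R).arrow ≫ (ihom (L.ar R)).map d := by
        rw [reassoc_of% (hk j), Str.relMap_arrow, reassoc_of% (Str.relMap_arrow (i j) R), h']
      exact this
  choose d hd using key
  exact ⟨{
    desc := d
    fac s j := Str.Hom.ext ((congrArg _ (hd s)).trans (hc.fac _ j))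
    uniq s m hm := Str.Hom.ext ((hc.uniq ((forgetStr F L).mapCocone s) m.hom fun j =>
      congrArg Str.Hom.hom (hm j)).trans (hd s).symm) }⟩

variable {κ : Cardinal.{w}} [Fact κ.IsRegular] [IsCardinalLocallyPresentable V κ]

variable (D) in
/-- `κ`-directed colimits of structures exist, and are computed in `V`. -/
theorem exists_isColimit_str
    (htensor : ∀ X Y : V, IsCardinalPresentable X κ → IsCardinalPresentable Y κ →
      IsCardinalPresentable (X ⊗ Y) κ) (hL : L.IsAry κ) [IsCardinalFiltered J κ]
    [F.M.IsStableUnderColimitsOfShape J] :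
    ∃ c : Cocone D, Nonempty (IsColimit c) ∧
      Nonempty (IsColimit ((forgetStr F L).mapCocone c)) ∧
      ∀ R, Nonempty (IsColimit ((relFunctor F R).mapCocone c)) := by
  obtain ⟨a, ⟨ha⟩⟩ : ∃ a : Cocone (D ⋙ forgetStr F L), Nonempty (IsColimit a) :=
    ⟨_, ⟨colimit.isColimit _⟩⟩
  obtain ⟨l, hl⟩ : ∃ l : ∀ j, (D.obj j).carrier ⟶ a.pt, ∀ j, l j = a.ι.app j :=
    ⟨fun j => a.ι.app j, fun _ => rfl⟩
  have lw {i j : J} (f : i ⟶ j) : (D.map f).hom ≫ l j = l i := by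
    rw [hl, hl]
    exact a.w f
  have lw' {i j : J} (f : i ⟶ j) (Y : V) :
      (ihom Y).map (D.map f).hom ≫ (ihom Y).map (l j) = (ihom Y).map (l i) := by
    rw [← Functor.map_comp, lw]
  have hpow {Y : V} (hY : IsCardinalPresentable Y κ) : IsColimit ((ihom Y).mapCocone a) :=
    (nonempty_isColimit_mapCocone_ihom κ htensor hY ha).some
  -- The power by the input arity preserves the colimit, so the operations at the stages induce one
  -- on the colimit.
  have hfn (f : L.Fun) : ∃ g : (ihom (L.dom f)).obj a.pt ⟶ (ihom (L.cod f)).obj a.pt,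
      ∀ j, (ihom (L.dom f)).map (l j) ≫ g = (D.obj j).fn f ≫ (ihom (L.cod f)).map (l j) := by
    refine ⟨(hpow (hL.1 f)).desc ⟨_,
      { app j := (D.obj j).fn f ≫ (ihom (L.cod f)).map (l j)
        naturality i j g := ?_ }⟩, fun j => ?_⟩
    · have : (ihom (L.dom f)).map (D.map g).hom ≫ (D.obj j).fn f ≫ (ihom (L.cod f)).map (l j) =
          (D.obj i).fn f ≫ (ihom (L.cod f)).map (l i) := by
        rw [← Category.assoc, (D.map g).fn_comm, Category.assoc, lw']
      exact this.trans (Category.comp_id _).symm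
    · exact Eq.trans (congrArg (fun x => (ihom _).map x ≫ _) (hl j)) ((hpow (hL.1 f)).fac _ j)
  have hrel (R : L.Rel) : ∃ S : Subobject ((ihom (L.ar R)).obj a.pt), F.M S.arrow ∧
      ∃ r : D ⋙ relFunctor F R ⟶ (Functor.const J).obj (S : V),
        Nonempty (IsColimit (Cocone.mk _ r)) ∧
        ∀ j, r.app j ≫ S.arrow = ((D.obj j).rel R).arrow ≫ (ihom (L.ar R)).map (l j) := by
    obtain ⟨ρ, hρ⟩ : ∃ ρ : colimit (D ⋙ relFunctor F R) ⟶ (ihom (L.ar R)).obj a.pt,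
        ∀ j, colimit.ι (D ⋙ relFunctor F R) j ≫ ρ =
          ((D.obj j).rel R).arrow ≫ (ihom (L.ar R)).map (l j) := by
      refine ⟨colimit.desc (D ⋙ relFunctor F R) ⟨_,
        { app j := ((D.obj j).rel R).arrow ≫ (ihom (L.ar R)).map (l j)
          naturality i j g := ?_ }⟩, fun j => colimit.ι_desc _ _⟩
      have : Str.relMap (D.map g) R ≫ ((D.obj j).rel R).arrow ≫ (ihom (L.ar R)).map (l j) =
          ((D.obj i).rel R).arrow ≫ (ihom (L.ar R)).map (l i) := by
        rw [← Category.assoc, Str.relMap_arrow, Category.assoc, lw']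
      exact this.trans (Category.comp_id _).symm
    -- The colimit of the relations is a subobject of the power of the colimit precisely because `M`
    -- is closed under directed colimits.
    have hM : F.M ρ :=
      MorphismProperty.IsStableUnderColimitsOfShape.condition (W := F.M)
        (D ⋙ relFunctor F R) ((D ⋙ forgetStr F L) ⋙ ihom (L.ar R)) (colimit.cocone _)
        ((ihom (L.ar R)).mapCocone a) (colimit.isColimit _) (hpow (hL.2.2 R))
        { app j := ((D.obj j).rel R).arrow
          naturality _ _ f := Str.relMap_arrow (D.map f) R }
        (fun j => (D.obj j).rel_mem R) _ (fun j => (hρ j).trans (by rw [hl]; rfl))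
    have := F.mono_of_M _ hM
    refine ⟨Subobject.mk ρ, F.M_mk_arrow _ hM, (colimit.cocone (D ⋙ relFunctor F R)).ι ≫
      (Functor.const J).map (Subobject.underlyingIso ρ).inv,
      ⟨(colimit.isColimit (D ⋙ relFunctor F R)).ofIsoColimit
        (Cocone.ext (Subobject.underlyingIso ρ).symm fun j => rfl)⟩, fun j => ?_⟩
    exact ((Category.assoc _ _ _).trans
      (congrArg _ (Subobject.underlyingIso_arrow ρ))).trans (hρ j)
  choose fn hfn using hfn
  choose S hS r hr hr' using hrel
  let c : Cocone D :=
    { pt := ⟨a.pt, fn, S, hS⟩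
      ι :=
        { app j := ⟨l j, fun f => hfn f j, fun R => ⟨(r R).app j, hr' R j⟩⟩
          naturality i j f := Str.Hom.ext ((lw f).trans (Category.comp_id _).symm) } }
  have hc : IsColimit ((forgetStr F L).mapCocone c) :=
    ha.ofIsoColimit (Cocone.ext (Iso.refl _) fun j =>
      (Category.comp_id _).trans (hl j).symm)
  have hcr (R : L.Rel) : IsColimit ((relFunctor F R).mapCocone c) :=
    (hr R).some.ofIsoColimit (Cocone.ext (Iso.refl _) fun j => by
      refine (Category.comp_id _).trans ?_
      refine (cancel_mono (S R).arrow).1 ((hr' R j).trans ?_)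
      exact (Str.relMap_arrow (c.ι.app j) R).symm)
  exact ⟨c, nonempty_isColimit_of_forgetStr_relFunctor c hc
    (fun f => (nonempty_isColimit_mapCocone_ihom κ htensor (hL.1 f) hc).some) hcr, ⟨hc⟩,
    fun R => ⟨hcr R⟩⟩

/-- An arbitrary colimit cocone is isomorphic to the one computed in `V`, so it inherits these
properties. -/
theorem nonempty_isColimit_forgetStr_relFunctor
    (htensor : ∀ X Y : V, IsCardinalPresentable X κ → IsCardinalPresentable Y κ →
      IsCardinalPresentable (X ⊗ Y) κ) (hL : L.IsAry κ) [IsCardinalFiltered J κ]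
    [F.M.IsStableUnderColimitsOfShape J] {c : Cocone D} (hc : IsColimit c) :
    Nonempty (IsColimit ((forgetStr F L).mapCocone c)) ∧
      ∀ R, Nonempty (IsColimit ((relFunctor F R).mapCocone c)) := by
  obtain ⟨c', ⟨h⟩, ⟨h₁⟩, h₂⟩ := exists_isColimit_str D htensor hL
  let e := h.uniqueUpToIso hc
  exact ⟨⟨h₁.ofIsoColimit ((Cocone.functoriality D (forgetStr F L)).mapIso e)⟩,
    fun R => ⟨(h₂ R).some.ofIsoColimit ((Cocone.functoriality D (relFunctor F R)).mapIso e)⟩⟩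

end RelFunctor

/-! ### Functors preserving a given colimit, and operations on them -/

section FunctorColimits

universe v' u'

variable {V : Type u} [Category.{w} V] {C : Type u'} [Category.{v'} C]
  {J : Type w} [SmallCategory J] {D : J ⥤ C} {c : Cocone D}

/-- The equalizer of two natural transformations. -/
@[simps]
def equalizerFunctor [HasLimits V] {H K : C ⥤ V} (σ τ : H ⟶ K) : C ⥤ V where
  obj A := equalizer (σ.app A) (τ.app A)
  map f := equalizer.lift (equalizer.ι _ _ ≫ H.map f) (by
    rw [Category.assoc, Category.assoc, σ.naturality, τ.naturality, equalizer.condition_assoc])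
  map_id A := by ext; simp
  map_comp f g := by ext; simp

/-- The inclusion of the equalizer of two natural transformations. -/
@[simps]
def equalizerFunctorι [HasLimits V] {H K : C ⥤ V} (σ τ : H ⟶ K) : equalizerFunctor σ τ ⟶ H where
  app _ := equalizer.ι _ _
  naturality _ _ _ := equalizer.lift_ι _ _

/-- The coproduct of a family of functors. -/
@[simps]
def sigmaFunctor [HasColimits V] {I : Type w} (G : I → C ⥤ V) : C ⥤ V where
  obj A := ∐ fun k => (G k).obj A
  map f := Limits.Sigma.map fun k => (G k).map f

/-- Colimits commute with coproducts: a cocone under the coproduct functor is a family of cocones,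
one for each summand. -/
theorem nonempty_isColimit_sigmaFunctor [HasColimits V] {I : Type w} (G : I → C ⥤ V)
    (hG : ∀ k, Nonempty (IsColimit ((G k).mapCocone c))) :
    Nonempty (IsColimit ((sigmaFunctor G).mapCocone c)) := by
  have hG k := (hG k).some
  have aux {X Y : I → V} {W : V} (p : ∀ k, X k ⟶ Y k) (q : ∐ Y ⟶ W) (k : I) :
      Sigma.ι X k ≫ Limits.Sigma.map p ≫ q = p k ≫ Sigma.ι Y k ≫ q :=
    Sigma.ι_map_assoc _ _ _
  exact ⟨{
    desc s := Sigma.desc fun k => (hG k).desc ⟨s.pt,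
      { app j := Sigma.ι (fun k => (G k).obj (D.obj j)) k ≫ s.ι.app j
        naturality i j f := by
          refine (aux (fun k => (G k).map (D.map f)) (s.ι.app j) k).symm.trans ?_
          exact (congrArg (Sigma.ι (fun k => (G k).obj (D.obj i)) k ≫ ·) (s.w f)).trans
            (Category.comp_id _).symm }⟩
    fac s j := Sigma.hom_ext _ _ fun k => by
      refine (aux (fun k => (G k).map (c.ι.app j)) _ k).trans ?_
      rw [Sigma.ι_desc]
      exact (hG k).fac _ j
    uniq s m hm := Sigma.hom_ext _ _ fun k => (hG k).hom_ext fun j => by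
      rw [Sigma.ι_desc, IsColimit.fac]
      exact (aux (fun k => (G k).map (c.ι.app j)) m k).symm.trans
        (congrArg (Sigma.ι (fun k => (G k).obj (D.obj j)) k ≫ ·) (hm j)) }⟩

theorem FactorizationSystem.nonempty_isColimit_of_factorization [MonoidalCategory V]
    [HasColimits V] (F : FactorizationSystem V) [F.M.IsStableUnderColimitsOfShape J]
    {G I H : C ⥤ V} (e : G ⟶ I) (m : I ⟶ H) (he : ∀ A, F.E (e.app A)) (hm : ∀ A, F.M (m.app A))
    (hG : Nonempty (IsColimit (G.mapCocone c))) (hH : Nonempty (IsColimit (H.mapCocone c))) :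
    Nonempty (IsColimit (I.mapCocone c)) := by
  have : Mono (m.app c.pt) := F.mono_of_M _ (hm _)
  exact ⟨F.isColimitOfFactorization (D.whiskerLeft e) (D.whiskerLeft m) (fun j => hm _)
    hG.some hH.some (e.app c.pt) (he _) (m.app c.pt) (fun j => e.naturality _)
    (fun j => m.naturality _)⟩

variable (κ : Cardinal.{w}) [Fact κ.IsRegular] [IsCardinalFiltered J κ]

theorem exists_factorization_of_isColimit_mapCocone {G H : C ⥤ V} (m : G ⟶ H)
    (hG : Nonempty (IsColimit (G.mapCocone c))) (hH : Nonempty (IsColimit (H.mapCocone c)))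
    {Z : V} (hZ : IsCardinalPresentable Z κ) {j : J} (l : Z ⟶ H.obj (D.obj j))
    (hl : ∃ f : Z ⟶ G.obj c.pt, f ≫ m.app c.pt = l ≫ H.map (c.ι.app j)) :
    ∃ (j' : J) (a : j ⟶ j') (l' : Z ⟶ G.obj (D.obj j')),
      l' ≫ m.app (D.obj j') = l ≫ H.map (D.map a) := by
  obtain ⟨f, hf⟩ := hl
  exact exists_factorization_of_isColimit κ (D.whiskerLeft m) hG.some hH.some (m.app c.pt)
    (fun j => m.naturality _) hZ l f hf.symm

variable [IsCardinalLocallyPresentable V κ]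

theorem nonempty_isColimit_mapCocone_of_mono {G H : C ⥤ V} (m : G ⟶ H) [∀ A, Mono (m.app A)]
    (hH : Nonempty (IsColimit (H.mapCocone c)))
    (hsurj : ∀ (Z : V), IsCardinalPresentable Z κ → ∀ (j : J) (l : Z ⟶ H.obj (D.obj j)),
      (∃ f : Z ⟶ G.obj c.pt, f ≫ m.app c.pt = l ≫ H.map (c.ι.app j)) →
        ∃ (j' : J) (a : j ⟶ j') (l' : Z ⟶ G.obj (D.obj j')),
          l' ≫ m.app (D.obj j') = l ≫ H.map (D.map a)) :
    Nonempty (IsColimit (G.mapCocone c)) := by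
  have (j : J) : Mono ((D.whiskerLeft m).app j) := inferInstanceAs (Mono (m.app (D.obj j)))
  exact nonempty_isColimit_of_mono κ (D.whiskerLeft m) hH.some (m.app c.pt)
    (fun j => m.naturality _) fun Z hZ j l f hf => hsurj Z hZ j l ⟨f, hf.symm⟩

/-- `κ`-filtered colimits commute with equalizers. -/
theorem nonempty_isColimit_equalizerFunctor (κ : Cardinal.{w}) [Fact κ.IsRegular]
    [IsCardinalFiltered J κ] [IsCardinalLocallyPresentable V κ] [HasLimits V] {H K : C ⥤ V} (σ τ : H ⟶ K)
    (hH : Nonempty (IsColimit (H.mapCocone c))) (hK : Nonempty (IsColimit (K.mapCocone c))) :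
    Nonempty (IsColimit ((equalizerFunctor σ τ).mapCocone c)) := by
  have (A : C) : Mono ((equalizerFunctorι σ τ).app A) :=
    inferInstanceAs (Mono (equalizer.ι _ _))
  refine nonempty_isColimit_mapCocone_of_mono κ (equalizerFunctorι σ τ) hH
    fun Z hZ j l hl => ?_
  -- The two composites agree in the colimit, so by presentability of `Z` they agree at some stage;
  -- there `l` factors through the equalizer.
  obtain ⟨j', a, ha⟩ := IsCardinalPresentable.exists_eq_of_isColimit' κ hK.some
    (l ≫ σ.app (D.obj j)) (l ≫ τ.app (D.obj j)) (by
      let i : D.obj j ⟶ c.pt := c.ι.app j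
      obtain ⟨f, h⟩ : ∃ f : Z ⟶ equalizer (σ.app c.pt) (τ.app c.pt),
        f ≫ equalizer.ι _ _ = l ≫ H.map i := hl
      have h' : (l ≫ σ.app (D.obj j)) ≫ K.map i = (l ≫ τ.app (D.obj j)) ≫ K.map i := by
        rw [Category.assoc, Category.assoc, ← σ.naturality, ← τ.naturality, ← Category.assoc,
          ← Category.assoc, ← h, Category.assoc, Category.assoc, equalizer.condition]
      exact h')
  have ha' : (l ≫ σ.app (D.obj j)) ≫ K.map (D.map a) =
    (l ≫ τ.app (D.obj j)) ≫ K.map (D.map a) := ha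
  refine ⟨j', a, equalizer.lift (l ≫ H.map (D.map a)) ?_, equalizer.lift_ι _ _⟩
  rw [Category.assoc, Category.assoc, σ.naturality, τ.naturality, ← Category.assoc, ha',
    Category.assoc]

/-- `κ`-filtered colimits commute with pullbacks of subobjects. -/
theorem nonempty_isColimit_of_pullback (κ : Cardinal.{w}) [Fact κ.IsRegular]
    [IsCardinalFiltered J κ] [IsCardinalLocallyPresentable V κ] {G H K H' : C ⥤ V} (m : G ⟶ H) [∀ A, Mono (m.app A)]
    (n : K ⟶ H') (t : H ⟶ H')
    (h : ∀ (A : C) {Z : V} (f : Z ⟶ H.obj A), (∃ g : Z ⟶ G.obj A, g ≫ m.app A = f) ↔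
      ∃ g : Z ⟶ K.obj A, g ≫ n.app A = f ≫ t.app A)
    (hH : Nonempty (IsColimit (H.mapCocone c))) (hK : Nonempty (IsColimit (K.mapCocone c)))
    (hH' : Nonempty (IsColimit (H'.mapCocone c))) : Nonempty (IsColimit (G.mapCocone c)) := by
  refine nonempty_isColimit_mapCocone_of_mono κ m hH fun Z hZ j l hl => ?_
  obtain ⟨g, hg⟩ := (h _ _).1 hl
  obtain ⟨j', a, l', hl'⟩ := exists_factorization_of_isColimit_mapCocone κ n hK hH' hZ
    (l ≫ t.app (D.obj j)) ⟨g, hg.trans ((Category.assoc _ _ _).trans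
      ((congrArg (l ≫ ·) (t.naturality (c.ι.app j))).trans (Category.assoc _ _ _).symm))⟩
  obtain ⟨g', hg'⟩ := (h (D.obj j') (l ≫ H.map (D.map a))).2
    ⟨l', by rw [hl', Category.assoc, Category.assoc, t.naturality]⟩
  exact ⟨j', a, g', hg'⟩

/-- `κ`-filtered colimits commute with intersections of fewer than `κ` subobjects. -/
theorem nonempty_isColimit_of_inter {I : Type w} (hI : HasCardinalLT I κ) {G H : C ⥤ V}
    (m : G ⟶ H) [∀ A, Mono (m.app A)] {K : I → C ⥤ V} (n : ∀ k, K k ⟶ H)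
    (h : ∀ (A : C) {Z : V} (f : Z ⟶ H.obj A), (∃ g : Z ⟶ G.obj A, g ≫ m.app A = f) ↔
      ∀ k, ∃ g : Z ⟶ (K k).obj A, g ≫ (n k).app A = f)
    (hH : Nonempty (IsColimit (H.mapCocone c)))
    (hK : ∀ k, Nonempty (IsColimit ((K k).mapCocone c))) :
    Nonempty (IsColimit (G.mapCocone c)) := by
  refine nonempty_isColimit_mapCocone_of_mono κ m hH fun Z hZ j l hl => ?_
  choose j' a l' hl' using fun k => exists_factorization_of_isColimit_mapCocone κ (n k) (hK k) hH
    hZ l ((h _ _).1 hl k)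
  -- The bound on `I` matters here: each index yields its own stage, and fewer than `κ` stages under
  -- `j` have a common successor compatible with the maps from `j`.
  obtain ⟨j₀, a₀, b, hb⟩ := IsCardinalFiltered.wideSpan a hI
  obtain ⟨g, hg⟩ := (h (D.obj j₀) (l ≫ H.map (D.map b))).2 fun k =>
    ⟨l' k ≫ (K k).map (D.map (a₀ k)), by
      rw [Category.assoc, (n k).naturality, reassoc_of% (hl' k), ← H.map_comp, ← D.map_comp, hb]⟩
  exact ⟨j₀, b, g, hg⟩

end FunctorColimits

/-! ### Presentability of the arities of terms -/

section Presentable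

variable {V : Type u} [Category.{w} V] [MonoidalCategory V] {L : Language.{w} V}
  {κ : Cardinal.{w}} [Fact κ.IsRegular] [IsCardinalLocallyPresentable V κ]

/-- `IsAry` records presentability at the leaves and a few nodes only. Tensor closure gives it for
powers, and closure under coproducts of fewer than `κ` objects for tuples. -/
theorem Term.IsAry.isCardinalPresentable
    (htensor : ∀ X Y : V, IsCardinalPresentable X κ → IsCardinalPresentable Y κ →
      IsCardinalPresentable (X ⊗ Y) κ) {X Y : V} {t : Term L X Y} (ht : t.IsAry κ) :
    IsCardinalPresentable X κ ∧ IsCardinalPresentable Y κ := by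
  induction t with
  | ofHom f => exact ht
  | symb f => exact ht
  | pow t Z ih => exact ⟨htensor _ _ (ih ht.1).1 ht.2, htensor _ _ (ih ht.1).2 ht.2⟩
  | @tuple X J Y t ih =>
    refine ⟨ht.1, ?_⟩
    have (k : Discrete J) : IsCardinalPresentable ((Discrete.functor Y).obj k) κ :=
      (ih k.as (ht.2.2 k.as)).2
    exact isCardinalPresentable_of_isColimit' _ (coproductIsCoproduct Y) κ
      (by simpa using ht.2.1)
  | comp t s iht ihs => exact ⟨(iht ht.1).1, (ihs ht.2).2⟩

end Presentable

/-! ### Interpretations preserve directed colimits -/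

section InterpColimits

variable {V : Type u} [Category.{w} V] [MonoidalCategory V] [SymmetricCategory V]
  [MonoidalClosed V] {F : FactorizationSystem V} {L : Language.{w} V}

variable (F) in
/-- The inclusion of `R_A` in `A ^ X`. -/
@[simps]
def relι (R : L.Rel) : relFunctor F R ⟶ forgetStr F L ⋙ ihom (L.ar R) where
  app A := (A.rel R).arrow
  naturality _ _ h := Str.relMap_arrow h R

variable (F L) in
/-- The isomorphism `A ^ (X ⊗ Y) ≅ (A ^ X) ^ Y`, natural in the structure. -/
@[simps]
def ihomTensorNatTrans (X Y : V) :
    forgetStr F L ⋙ ihom (X ⊗ Y) ⟶ (forgetStr F L ⋙ ihom X) ⋙ ihom Y where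
  app A := (ihomTensorIso X Y A.carrier).hom
  naturality _ _ h := ihomTensorIso_hom_naturality X Y h.hom

section

variable [HasColimits V]

variable (F) in
/-- The interpretation of a term, as a natural transformation. -/
@[simps]
def termNatTrans {X Y : V} (t : Term L X Y) :
    forgetStr F L ⋙ ihom X ⟶ forgetStr F L ⋙ ihom Y where
  app A := A.term t
  naturality _ _ h := Str.map_term h t

variable [HasLimits V]

instance mono_interpι_app {X : V} (φ : Formula L X) (A : Str F L) :
    Mono ((interpι F φ).app A) :=
  inferInstanceAs (Mono (A.interp φ).arrow)

/-- Common argument for equality, existential quantification and disjunction. The `E`-parts are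
natural because the `M`-parts are monic and natural, so the statement about colimits of
factorizations applies. -/
theorem nonempty_isColimit_interp_of_image {J : Type w} [SmallCategory J]
    [F.M.IsStableUnderColimitsOfShape J] {D : J ⥤ Str F L} {c : Cocone D} {X : V}
    (φ : Formula L X) {G : Str F L ⥤ V} (f : G ⟶ forgetStr F L ⋙ ihom X)
    (h : ∀ A, A.interp φ = F.image (f.app A)) (hG : Nonempty (IsColimit (G.mapCocone c)))
    (hX : Nonempty (IsColimit ((forgetStr F L ⋙ ihom X).mapCocone c))) :
    Nonempty (IsColimit ((interpFunctor F φ).mapCocone c)) := by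
  have he (A : Str F L) : ∃ e : G.obj A ⟶ (A.interp φ : V),
      F.E e ∧ e ≫ (A.interp φ).arrow = f.app A := by
    rw [h]
    exact F.exists_image _
  choose e he he' using he
  refine F.nonempty_isColimit_of_factorization (e := { app := e, naturality := ?_ })
    (interpι F φ) he (fun A => A.M_interp_arrow φ) hG hX
  intro A B g
  refine (cancel_mono (B.interp φ).arrow).1 ?_
  have h1 : (G.map g ≫ e B) ≫ (B.interp φ).arrow = f.app A ≫ (ihom X).map g.hom := by
    rw [Category.assoc, he']
    exact f.naturality g
  have h2 : (e A ≫ Str.interpMap g φ) ≫ (B.interp φ).arrow = f.app A ≫ (ihom X).map g.hom := by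
    rw [Category.assoc, Str.interpMap_arrow, ← Category.assoc, he']
    rfl
  exact h1.trans h2.symm

end

variable {κ : Cardinal.{w}} [Fact κ.IsRegular] [IsCardinalLocallyPresentable V κ] [HasLimits V]

/-- Interpretations of the formulas of `𝕃_{κκ}` preserve `κ`-directed colimits. -/
theorem nonempty_isColimit_interp
    (htensor : ∀ X Y : V, IsCardinalPresentable X κ → IsCardinalPresentable Y κ →
      IsCardinalPresentable (X ⊗ Y) κ) {J : Type w} [SmallCategory J] [IsCardinalFiltered J κ]
    [F.M.IsStableUnderColimitsOfShape J] {D : J ⥤ Str F L} {c : Cocone D}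
    (hc : IsColimit ((forgetStr F L).mapCocone c))
    (hR : ∀ R, Nonempty (IsColimit ((relFunctor F R).mapCocone c))) {X : V} (φ : Formula L X)
    (hφ : φ.IsAry κ) : Nonempty (IsColimit ((interpFunctor F φ).mapCocone c)) := by
  have hpow {Y : V} (hY : IsCardinalPresentable Y κ) :
      Nonempty (IsColimit ((forgetStr F L ⋙ ihom Y).mapCocone c)) :=
    nonempty_isColimit_mapCocone_ihom κ htensor hY hc
  induction φ with
  | @eq X Y s t =>
    have h := Term.IsAry.isCardinalPresentable (κ := κ) htensor hφ.1
    exact nonempty_isColimit_interp_of_image _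
      (equalizerFunctorι (termNatTrans F s) (termNatTrans F t)) (fun A => rfl)
      (nonempty_isColimit_equalizerFunctor κ _ _ (hpow h.1) (hpow h.2)) (hpow h.1)
  | @rel R Y Z t =>
    obtain ⟨hR', hY, ht⟩ := hφ
    have hZ := (Term.IsAry.isCardinalPresentable (κ := κ) htensor ht).1
    refine nonempty_isColimit_of_pullback κ (interpι F (.rel R Y t))
      (Functor.whiskerRight (relι F R) (ihom Y)) (termNatTrans F t ≫ ihomTensorNatTrans F L _ Y)
      (fun A W f => ?_) (hpow hZ)
      (nonempty_isColimit_mapCocone_ihom κ htensor hY (hR R).some)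
      (nonempty_isColimit_mapCocone_ihom κ htensor hY (hpow hR').some)
    refine (factors_iff_exists (A.interp (.rel R Y t)) f).symm.trans ?_
    exact (pullback_factors_iff _ _ _).trans (mk_factors_iff_exists _ _)
  | @conj X I φ ih =>
    refine nonempty_isColimit_of_inter κ hφ.2.1 (interpι F (.conj φ))
      (fun k => interpι F (φ k)) (fun A W f => ?_) (hpow hφ.1) (fun k => ih k (hφ.2.2 k))
    refine (factors_iff_exists (A.interp (.conj φ)) f).symm.trans ?_
    exact (inter_factors_iff _ _).trans (forall_congr' fun k => factors_iff_exists _ _)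
  | @ex X Y ψ ih =>
    exact nonempty_isColimit_interp_of_image _
      (interpι F ψ ≫ Functor.whiskerLeft (forgetStr F L)
        (MonoidalClosed.pre (coprod.inl : X ⟶ X ⨿ Y))) (fun A => rfl) (ih hφ.2.2) (hpow hφ.1)
  | @disj X I φ ih =>
    refine nonempty_isColimit_interp_of_image _
      (G := sigmaFunctor fun k => interpFunctor F (φ k))
      { app A := Sigma.desc fun k => (A.interp (φ k)).arrow
        naturality A B g := Sigma.hom_ext _ _ fun k => ?_ } (fun A => rfl)
      (nonempty_isColimit_sigmaFunctor _ fun k => ih k (hφ.2.2 k)) (hpow hφ.1)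
    have : Sigma.ι (fun k => (A.interp (φ k) : V)) k ≫
        (Limits.Sigma.map fun k => Str.interpMap g (φ k)) ≫
          (Sigma.desc fun k => (B.interp (φ k)).arrow) =
        Sigma.ι (fun k => (A.interp (φ k) : V)) k ≫
          (Sigma.desc fun k => (A.interp (φ k)).arrow) ≫ (ihom X).map g.hom := by
      simp [Str.interpMap_arrow]
    exact this

/-- Models of basic theories are closed under `κ`-directed colimits of structures. -/
theorem Mod.isClosedUnderColimitsOfShape
    (htensor : ∀ X Y : V, IsCardinalPresentable X κ → IsCardinalPresentable Y κ →
      IsCardinalPresentable (X ⊗ Y) κ) (hL : L.IsAry κ) {T : Set (Sequent L)}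
    (hT : ∀ σ ∈ T, σ.lhs.IsAry κ) (J : Type w) [SmallCategory J] [IsCardinalFiltered J κ]
    [F.M.IsStableUnderColimitsOfShape J] :
    (Mod F T).IsClosedUnderColimitsOfShape J where
  colimitsOfShape_le := by
    rintro A ⟨p⟩ σ hσ
    obtain ⟨⟨hc⟩, hR⟩ := nonempty_isColimit_forgetStr_relFunctor htensor hL p.isColimit
    have h := (nonempty_isColimit_interp htensor hc hR σ.lhs (hT σ hσ)).some
    let i (j : J) : p.diag.obj j ⟶ A := p.ι.app j
    -- Only the left-hand formula has to preserve the colimit, since the map is built out of it; for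
    -- the right-hand one functoriality is enough.
    let k (j : J) : ((p.diag.obj j).interp σ.lhs : V) ⟶ (A.interp σ.rhs : V) :=
      Subobject.ofLE _ _ (p.prop_diag_obj j σ hσ) ≫ Str.interpMap (i j) σ.rhs
    have hk (j : J) : k j ≫ (A.interp σ.rhs).arrow =
        ((p.diag.obj j).interp σ.lhs).arrow ≫ (ihom σ.arity).map (i j).hom := by
      simp [k, Str.interpMap_arrow]
    obtain ⟨m, hm⟩ : ∃ m : (A.interp σ.lhs : V) ⟶ (A.interp σ.rhs : V),
        ∀ j, Str.interpMap (i j) σ.lhs ≫ m = k j := by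
      refine ⟨h.desc ⟨(A.interp σ.rhs : V), { app := k, naturality := fun j j' f => ?_ }⟩,
        fun j => h.fac _ j⟩
      refine (cancel_mono (A.interp σ.rhs).arrow).1 ?_
      have hi : (p.diag.map f).hom ≫ (i j').hom = (i j).hom :=
        congrArg Str.Hom.hom (p.w f)
      have h1 : (Str.interpMap (p.diag.map f) σ.lhs ≫ k j') ≫ (A.interp σ.rhs).arrow =
          k j ≫ (A.interp σ.rhs).arrow := by
        rw [Category.assoc, hk, hk, ← Category.assoc, Str.interpMap_arrow, Category.assoc,
          ← Functor.map_comp, hi]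
      exact h1.trans (congrArg (· ≫ (A.interp σ.rhs).arrow) (Category.comp_id (k j)).symm)
    refine Subobject.le_of_comm m (h.hom_ext fun j => ?_)
    have : Str.interpMap (i j) σ.lhs ≫ m ≫ (A.interp σ.rhs).arrow =
        Str.interpMap (i j) σ.lhs ≫ (A.interp σ.lhs).arrow := by
      rw [reassoc_of% (hm j), hk, Str.interpMap_arrow]
    exact this

end InterpColimits

end

end EnrichedLogic

theorem mainTheorem8 {V : Type u} [Category.{w} V] [MonoidalCategory V] [SymmetricCategory V]
    [MonoidalClosed V] (κ : Cardinal.{w}) [Fact κ.IsRegular] [IsCardinalLocallyPresentable V κ]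
    (hunit : IsCardinalPresentable (𝟙_ V) κ)
    (htensor : ∀ X Y : V, IsCardinalPresentable X κ → IsCardinalPresentable Y κ →
      IsCardinalPresentable (X ⊗ Y) κ)
    (F : EnrichedLogic.FactorizationSystem V) (hF : F.IsClosedUnderDirectedColimits κ)
    (L : EnrichedLogic.Language.{w} V) (hL : L.IsAry κ)
    (T : Set (EnrichedLogic.Sequent L)) (hT : EnrichedLogic.IsBasicTheory κ T) :
    haveI : HasLimits V := EnrichedLogic.hasLimits_of_isCardinalLocallyPresentable V κ
    (∀ (J : Type w) [PartialOrder J] [IsCardinalFiltered J κ],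
      (EnrichedLogic.Mod F T).IsClosedUnderColimitsOfShape J) ∧
    (EnrichedLogic.ElementaryIsPEStable κ F L →
      ∀ (K N : EnrichedLogic.Str F L) (f : K ⟶ N), EnrichedLogic.IsElementary κ f →
        EnrichedLogic.Mod F T N → EnrichedLogic.Mod F T K) ∧
    (∀ X : V, F.IsStable X → EnrichedLogic.IsVConnected X →
      ∀ (A P : EnrichedLogic.Str F L) (ε : X ⊗ P.carrier ⟶ A.carrier),
        EnrichedLogic.IsPower X A P ε → EnrichedLogic.Mod F T A → EnrichedLogic.Mod F T P) := by
  have : HasLimits V := EnrichedLogic.hasLimits_of_isCardinalLocallyPresentable V κ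
  refine ⟨fun J _ _ => ?_, fun hPE K N f hf hN => ?_, fun X hX hX' A P ε hP hA => ?_⟩
  · have := hF J
    exact EnrichedLogic.Mod.isClosedUnderColimitsOfShape htensor hL (fun σ hσ => (hT σ hσ).1.2) J
  · exact EnrichedLogic.Mod.of_isElementaryFor f
      (fun σ hσ => hPE f hf σ.rhs (hT σ hσ).2.1 (hT σ hσ).2.2) hN
  · exact EnrichedLogic.Mod.of_isPower hX hX' hP hA
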